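/- **Theorem 1.1 (Well-posedness).** Let $0<c<1$, $Z>0$, $$A=\mathrm{diag}(1,-1,c,-c),\qquad B=\frac12\begin{bmatrix}0&0&-1-c&-1+c\\0&0&1-c&1+c\\1+c&-1+c&0&0\\1-c&-1-c&0&0\end{bmatrix},$$ and let $\beta\in C^1[0,Z]$ be real valued with $\beta(0)=\beta'(0)=0$. (a) The characteristic boundary value problem $$\mathbf m_t=A\mathbf m_z+\beta B\mathbf m\quad\text{on } T=\{0\le z\le t\le 2Z-z\},$$ $$m_2(0,t)=m_4(0,t)=0\quad(0\le t\le 2Z),$$ $$m_1(z,z)=0,\quad m_3(z,z)=\frac{c-1}{2(c+1)}\beta(z),\quad m_4(z,z)=\frac{c+1}{2(c-1)}\beta(z)\quad(0\le z\le Z)$$ has a unique solution $\mathbf m\in C^1(T;\mathbb R^4)$. (b) Let $\beta$ be extended in any way to a $C^1$ function on $\mathbb R$. Then the impulsive initial boundary value problem $$\mathbf M_t=A\mathbf M_z+\beta B\mathbf M\ \ (z\ge0),\qquad M_2(0,t)=\delta(t),\quad M_4(0,t)=0,\qquad \mathbf M=0\ \text{ for } t<0,$$ has, on the region $\{z\ge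 0,\ z+t<2Z\}$, a unique distribution solution $\mathbf M$ of order at most one. It does not depend on the extension, and it is $$\mathbf M(z,t)=\delta(t-z)\,[0,1,0,0]^T+\mathbf m(z,t)\,H(t-z),$$ where $H$ is the Heaviside function and $\mathbf m$ is the function from (a); in particular $\mathbf M=0$ where $t<z$, so that $\mathbf M$ is carried by $\{0\le z\le Z\}$. Here an $\mathbb R^4$-valued distribution $\mathbf M$ on $\{z\ge0,\ z+t<2Z\}$ is identified with its extension by zero to $\{z+t<2Z\}$, and it is a solution if it vanishes for $t<0$ and if there is an $\mathbb R^4$-valued distribution $\mathbf b(t)=\mathbf M(0,t)$ of order at most two on $\{t<2Z\}$ (the boundary value of $\mathbf M$) with $b_2=\delta$, $b_4=0$ and $$\mathbf M_t-A\mathbf M_z-\beta B\mathbf M=-\,\delta(z)\,A\,\mathbf b(t)\quad\text{in the sense of distributions on }\{z+t<2Z\}.$$ -/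

import Mathlib

open Set MeasureTheory TopologicalSpace
open scoped Distributions Matrix

namespace TwistedFiber

noncomputable section

/-- The matrix `A` of propagation velocities. Indices are shifted by one: the entries `0, 1, 2, 3`
of a vector here are the components `1, 2, 3, 4` of the mathematical text. -/
def A (c : ℝ) : Matrix (Fin 4) (Fin 4) ℝ :=
  !![1,  0, 0,  0;
     0, -1, 0,  0;
     0,  0, c,  0;
     0,  0, 0, -c]

/-- The coupling matrix `B`. -/
def B (c : ℝ) : Matrix (Fin 4) (Fin 4) ℝ :=
  (1 / 2 : ℝ) •
  !![    0,      0, -1 - c, -1 + c;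
         0,      0,  1 - c,  1 + c;
     1 + c, -1 + c,      0,      0;
     1 - c, -1 - c,      0,      0]

/-- The closed triangle `0 ≤ z ≤ t ≤ 2Z - z`. A point is written `x = (z, t)`. -/
def triangle (Z : ℝ) : Set (ℝ × ℝ) :=
  {x | 0 ≤ x.1 ∧ x.1 ≤ x.2 ∧ x.2 ≤ 2 * Z - x.1}

/-- `m` is a `C¹` solution, on the closed triangle `0 ≤ z ≤ t ≤ 2Z - z`, of the characteristic
boundary value problem. Derivatives at boundary points of the triangle are the one-sided ones. -/
structure IsCharacteristicSolution (c Z : ℝ) (β : ℝ → ℝ) (m : ℝ × ℝ → Fin 4 → ℝ) : Prop where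
  contDiffOn : ContDiffOn ℝ 1 m (triangle Z)
  pde : ∀ x ∈ triangle Z,
    fderivWithin ℝ m (triangle Z) x (0, 1) =
      A c *ᵥ fderivWithin ℝ m (triangle Z) x (1, 0) + β x.1 • (B c *ᵥ m x)
  left : ∀ t ∈ Icc 0 (2 * Z), m (0, t) 1 = 0 ∧ m (0, t) 3 = 0
  diagonal : ∀ z ∈ Icc 0 Z,
    m (z, z) 0 = 0 ∧
    m (z, z) 2 = (c - 1) / (2 * (c + 1)) * β z ∧
    m (z, z) 3 = (c + 1) / (2 * (c - 1)) * β z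

/-- The open half-plane `z + t < 2Z`. -/
def halfPlane (Z : ℝ) : Opens (ℝ × ℝ) :=
  ⟨{x | x.1 + x.2 < 2 * Z}, isOpen_lt (by fun_prop) (by fun_prop)⟩

/-- The open half-line `t < 2Z`, which is the line `z = 0` inside `z + t < 2Z`. -/
def timeLine (Z : ℝ) : Opens ℝ :=
  ⟨{t | t < 2 * Z}, isOpen_lt (by fun_prop) (by fun_prop)⟩

/-- The test function `β(z) φ(z,t)`. -/
def mulTest {Z : ℝ} (β : ℝ → ℝ) (hβ : ContDiff ℝ 1 β) (φ : 𝓓^{2}(halfPlane Z, ℝ)) :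
    𝓓^{1}(halfPlane Z, ℝ) where
  toFun x := β x.1 * φ x
  contDiff' := (hβ.comp contDiff_fst).mul (φ.contDiff.of_le (by norm_num))
  hasCompactSupport' := φ.hasCompactSupport.mul_left
  tsupport_subset' := (tsupport_mul_subset_right).trans φ.tsupport_subset

/-- The restriction `t ↦ φ(0,t)` of a test function to the line `z = 0`. -/
def traceTest {Z : ℝ} (φ : 𝓓^{2}(halfPlane Z, ℝ)) : 𝓓^{2}(timeLine Z, ℝ) where
  toFun t := φ (0, t)
  contDiff' := φ.contDiff.comp (contDiff_prodMk_right (0 : ℝ))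
  hasCompactSupport' :=
    HasCompactSupport.intro (φ.hasCompactSupport.isCompact.image continuous_snd) fun t ht => by
      by_contra h
      exact ht ⟨(0, t), subset_tsupport φ h, rfl⟩
  tsupport_subset' := by
    intro t ht
    have h : ((0 : ℝ), t) ∈ tsupport φ :=
      tsupport_comp_subset_preimage φ (f := fun t : ℝ => ((0 : ℝ), t)) (by fun_prop) ht
    have h' := φ.tsupport_subset h
    simpa [halfPlane, timeLine] using h'

/-- The derivative `∂φ/∂z` of a test function. -/
def dz {Z : ℝ} (φ : 𝓓^{2}(halfPlane Z, ℝ)) : 𝓓^{1}(halfPlane Z, ℝ) :=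
  TestFunction.lineDerivCLM ℝ ((1, 0) : ℝ × ℝ) φ

/-- The derivative `∂φ/∂t` of a test function. -/
def dt {Z : ℝ} (φ : 𝓓^{2}(halfPlane Z, ℝ)) : 𝓓^{1}(halfPlane Z, ℝ) :=
  TestFunction.lineDerivCLM ℝ ((0, 1) : ℝ × ℝ) φ

/-- `M` is a distribution solution of the impulsive initial boundary value problem
`M_t = A M_z + β B M`, `M₂(0,t) = δ(t)`, `M₄(0,t) = 0`, `M = 0` for `t < 0`, in the part
`z + t < 2Z` of the half-plane `z ≥ 0`.

`M` is an `ℝ⁴`-valued distribution of order at most one, so that its product with the `C¹`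
function `β` is defined. A distribution on `z ≥ 0` is identified with its extension by zero to
`z < 0`. Such an `M` satisfies the equation and has the boundary values `M(0,·) = b` when, in the
sense of distributions on `z + t < 2Z`,
`M_t - A M_z - β B M = - A b(t) δ(z)`.
For a function `M` which is `C¹` up to `z = 0` this says that the equation holds for `z > 0` and
that `M(0,t) = b(t)` (Green's formula). Only the components `b₂` and `b₄` are prescribed. -/
structure IsImpulsiveSolution (c Z : ℝ) (β : ℝ → ℝ) (hβ : ContDiff ℝ 1 β)
    (M : 𝓓'^{1}(halfPlane Z, Fin 4 → ℝ)) : Prop where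
  /-- `M` lives on `z ≥ 0`. -/
  supported : ∀ φ : 𝓓^{1}(halfPlane Z, ℝ), tsupport φ ⊆ {x | x.1 < 0} → M φ = 0
  /-- `M = 0` for `t < 0`. -/
  initial : ∀ φ : 𝓓^{1}(halfPlane Z, ℝ), tsupport φ ⊆ {x | x.2 < 0} → M φ = 0
  /-- The differential equation and the boundary conditions. -/
  equation : ∃ b : 𝓓'^{2}(timeLine Z, Fin 4 → ℝ),
    (∀ φ : 𝓓^{2}(halfPlane Z, ℝ),
      -(M (dt φ)) + A c *ᵥ M (dz φ) - B c *ᵥ M (mulTest β hβ φ) = -(A c *ᵥ b (traceTest φ))) ∧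
    (∀ χ : 𝓓^{2}(timeLine Z, ℝ), b χ 1 = χ 0) ∧
    (∀ χ : 𝓓^{2}(timeLine Z, ℝ), b χ 3 = 0)

/-- `M` is the distribution `δ(t - z) [0,1,0,0] + m(z,t) H(t - z)` on `z ≥ 0`, `z + t < 2Z`. The
test functions vanish for `z + t ≥ 2Z`, so the line `t = z` contributes only for `0 ≤ z ≤ Z`, and
`H(t - z)` restricts the second integral to the triangle. -/
def HasProgressingForm (Z : ℝ) (m : ℝ × ℝ → Fin 4 → ℝ)
    (M : 𝓓'^{1}(halfPlane Z, Fin 4 → ℝ)) : Prop :=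
  ∀ φ : 𝓓^{1}(halfPlane Z, ℝ),
    M φ = (∫ z in (0 : ℝ)..Z, φ (z, z)) • ![0, 1, 0, 0] + ∫ x in triangle Z, φ x • m x

end

end TwistedFiber

/-!
Both parts of the theorem rest on one fact: a linear hyperbolic system with straight
characteristics, integrated along them, is a system of Volterra integral equations, and these have
`C¹` solutions.

*Integral equations.* `CharSystem` describes such a system with arbitrary affine starting points of
the integration. If a weight decreases at unit rate from each point towards the points it depends
on (`CharSystem.IsVolterraWeight`), the integral operator is a contraction in a norm with
exponential weight. Applied to the solution and its time derivative together, this gives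
`CharSystem.exists_contDiff_solution`. The equations determine the remaining derivative.

*Existence.* The coefficient is extended to the line by zero for `z ≤ 0`. It stays `C¹` because
`β(0) = β'(0) = 0`. On the whole plane the first, third and fourth component are then integrated
from the diagonal and the second one from `z = 0` (`exists_isCharacteristicSolution`). The condition
`m₄(0,t) = 0` costs nothing, because the fourth characteristic through a point of `z = 0` starts on
the diagonal at a point with `z ≤ 0`, where the coefficient and the data vanish.
Green's formula on the triangle shows that `δ(t - z) [0,1,0,0] + m H(t - z)` solves the impulsive
problem: the boundary terms on the diagonal are those which `β B` produces from the delta function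
(`IsCharacteristicSolution.diagonal_balance`, `IsCharacteristicSolution.isImpulsiveSolution`).

*Uniqueness* is proved by duality. Let `D` be the difference of two impulsive solutions. The unknown
boundary values `b₁`, `b₃` disappear from the equation for `D` if the first and third component of
the test function vanish at `z = 0`. Given a source in `z + t ≤ ρ < 2Z`, the adjoint system has such
a solution, which vanishes for `z ≥ 0`, `z + t > ρ` (`exists_adjoint_solution`). It is only `C¹`,
while the test functions have to be `C²`. An average over `[t, t + ε]` gains a time derivative, and
through the equation the other one (`exists_contDiff_two_adjoint_solution`). Cut off in `z < 0` and
in `t < 0`, where `D` vanishes, it is an admissible test function. A distribution that is zero for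
`z < 0` and for `t < 0` depends only on the values of the test function in the closed quadrant
(`apply_eq_zero_of_eqOn_quadrant`), so `D` annihilates all averaged test functions, and by
continuity it is zero (`IsImpulsiveSolution.eq`).

Uniqueness of the characteristic solution follows: two of them give impulsive solutions, which
coincide, and the regular part of a progressing wave is determined by the distribution
(`HasProgressingForm.eqOn`).
-/

namespace TwistedFiber

open Filter Topology

/-! ### Calculus of integrals with parameters -/

/-- A function of two real variables with continuous partial derivatives is continuously
differentiable. -/
theorem hasFDerivAt_of_partials {f : ℝ → ℝ → ℝ} {f₁ f₂ : ℝ × ℝ → ℝ}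
    (h₁ : ∀ x y, HasDerivAt (fun x' => f x' y) (f₁ (x, y)) x)
    (h₂ : ∀ x y, HasDerivAt (fun y' => f x y') (f₂ (x, y)) y)
    (c₁ : Continuous f₁) (c₂ : Continuous f₂) (p : ℝ × ℝ) :
    HasFDerivAt (fun p : ℝ × ℝ => f p.1 p.2)
      (f₁ p • ContinuousLinearMap.fst ℝ ℝ ℝ + f₂ p • ContinuousLinearMap.snd ℝ ℝ ℝ) p := by
  have key := hasStrictFDerivAt_uncurry_coprod (𝕜 := ℝ) (u := p) (f := f)
    (f₁ := fun x y => ContinuousLinearMap.toSpanSingleton ℝ (f₁ (x, y)))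
    (f₂ := fun x y => ContinuousLinearMap.toSpanSingleton ℝ (f₂ (x, y)))
    (Eventually.of_forall fun v => (h₁ v.1 v.2).hasFDerivAt)
    (Eventually.of_forall fun v => (h₂ v.1 v.2).hasFDerivAt)
    (((ContinuousLinearMap.toSpanSingletonCLE (𝕜 := ℝ) (E := ℝ)).continuous.comp c₁).continuousAt)
    (((ContinuousLinearMap.toSpanSingletonCLE (𝕜 := ℝ) (E := ℝ)).continuous.comp c₂).continuousAt)
  refine HasFDerivAt.congr_fderiv (f := fun p : ℝ × ℝ => f p.1 p.2) key.hasFDerivAt ?_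
  ext <;> simp [Function.HasUncurry.uncurry]

theorem contDiff_one_of_partials {f : ℝ → ℝ → ℝ} {f₁ f₂ : ℝ × ℝ → ℝ}
    (h₁ : ∀ x y, HasDerivAt (fun x' => f x' y) (f₁ (x, y)) x)
    (h₂ : ∀ x y, HasDerivAt (fun y' => f x y') (f₂ (x, y)) y)
    (c₁ : Continuous f₁) (c₂ : Continuous f₂) :
    ContDiff ℝ 1 (fun p : ℝ × ℝ => f p.1 p.2) := by
  have key := hasFDerivAt_of_partials h₁ h₂ c₁ c₂
  rw [contDiff_one_iff_fderiv]
  refine ⟨fun p => (key p).differentiableAt, ?_⟩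
  rw [show fderiv ℝ (fun p : ℝ × ℝ => f p.1 p.2) = _ from funext fun p => (key p).fderiv]
  fun_prop

/-- Differentiation under the integral sign, for a continuous integrand with a continuous
derivative in the parameter. -/
theorem hasDerivAt_integral_of_continuous {F F' : ℝ → ℝ → ℝ}
    (hF : Continuous (Function.uncurry F)) (hF' : Continuous (Function.uncurry F'))
    (h : ∀ z y, HasDerivAt (F z) (F' z y) y) (a b y₀ : ℝ) :
    HasDerivAt (fun y => ∫ z in a..b, F z y) (∫ z in a..b, F' z y₀) y₀ := by
  obtain ⟨C, hC⟩ := (isCompact_uIcc.prod (isCompact_closedBall y₀ 1)).exists_bound_of_continuousOn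
    (s := uIcc a b ×ˢ Metric.closedBall y₀ 1) hF'.continuousOn
  have c1 (y : ℝ) : Continuous fun z => F z y := hF.comp (by fun_prop : Continuous fun z => (z, y))
  have c2 (y : ℝ) : Continuous fun z => F' z y :=
    hF'.comp (by fun_prop : Continuous fun z => (z, y))
  refine (intervalIntegral.hasDerivAt_integral_of_dominated_loc_of_deriv_le
    (F := fun y z => F z y) (F' := fun y z => F' z y) (bound := fun _ => C)
    (Metric.closedBall_mem_nhds y₀ one_pos) (Eventually.of_forall fun y => ?_)
    ((c1 y₀).intervalIntegrable _ _) (c2 y₀).aestronglyMeasurable ?_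
    intervalIntegrable_const ?_).2
  · exact (c1 y).aestronglyMeasurable
  · exact Eventually.of_forall fun z hz y hy => hC (z, y) ⟨uIoc_subset_uIcc hz, hy⟩
  · exact Eventually.of_forall fun z hz y hy => h z y

/-- Leibniz rule for an integral whose lower end point is an affine function of the parameter. -/
theorem hasDerivAt_integral_affine_left {F F' : ℝ → ℝ → ℝ}
    (hF : Continuous (Function.uncurry F)) (hF' : Continuous (Function.uncurry F'))
    (h : ∀ z y, HasDerivAt (F z) (F' z y) y) (k l b y₀ : ℝ) :
    HasDerivAt (fun y => ∫ z in (k * y + l)..b, F z y)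
      (-(k * F (k * y₀ + l) y₀) + ∫ z in (k * y₀ + l)..b, F' z y₀) y₀ := by
  have c1 (y : ℝ) : Continuous fun z => F z y := hF.comp (by fun_prop : Continuous fun z => (z, y))
  have hd := hasFDerivAt_of_partials (f := fun a y => ∫ z in a..b, F z y)
    (f₁ := fun p => -F p.1 p.2) (f₂ := fun p => ∫ z in p.1..b, F' z p.2)
    (fun a y => intervalIntegral.integral_hasDerivAt_left ((c1 y).intervalIntegrable _ _)
      ((c1 y).stronglyMeasurableAtFilter _ _) (c1 y).continuousAt)
    (fun a y => hasDerivAt_integral_of_continuous hF hF' h a b y)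
    (by
      have : Continuous fun p : ℝ × ℝ => F p.1 p.2 := hF
      fun_prop)
    (by
      simp_rw [intervalIntegral.integral_symm b]
      refine Continuous.neg ?_
      refine intervalIntegral.continuous_parametric_intervalIntegral_of_continuous
        (f := fun (p : ℝ × ℝ) z => F' z p.2) ?_ continuous_fst
      exact hF'.comp (by fun_prop : Continuous fun q : (ℝ × ℝ) × ℝ => (q.2, q.1.2)))
    (k * y₀ + l, y₀)
  have hlin : HasDerivAt (fun y : ℝ => (k * y + l, y)) (k, 1) y₀ := by
    refine HasDerivAt.prodMk ?_ (hasDerivAt_id _)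
    simpa using ((hasDerivAt_id y₀).const_mul k).add_const l
  have := HasFDerivAt.comp_hasDerivAt (f := fun y : ℝ => (k * y + l, y)) y₀ hd hlin
  refine this.congr_deriv ?_
  simp
  ring

theorem continuous_integral_endpoints {X : Type*} [TopologicalSpace X] {f : X → ℝ → ℝ}
    (hf : Continuous (Function.uncurry f)) {a b : X → ℝ} (ha : Continuous a) (hb : Continuous b) :
    Continuous fun x => ∫ t in (a x)..(b x), f x t := by
  have hi (x : X) (p q : ℝ) : IntervalIntegrable (f x) volume p q :=
    (hf.comp (by fun_prop : Continuous fun t => (x, t))).intervalIntegrable _ _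
  have : (fun x => ∫ t in (a x)..(b x), f x t)
      = fun x => (∫ t in (0 : ℝ)..(b x), f x t) - ∫ t in (0 : ℝ)..(a x), f x t := by
    ext x
    rw [intervalIntegral.integral_interval_sub_left (hi _ _ _) (hi _ _ _)]
  rw [this]
  exact (intervalIntegral.continuous_parametric_intervalIntegral_of_continuous hf hb).sub
    (intervalIntegral.continuous_parametric_intervalIntegral_of_continuous hf ha)

/-- Integrals along the parallel lines `x.2 + s * x.1 = y`, started at an affine function of the
label `y`, are continuously differentiable, and the derivative along the line is the integrand. -/
theorem contDiff_integral_along_lines {F F' : ℝ → ℝ → ℝ}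
    (hF : Continuous (Function.uncurry F)) (hF' : Continuous (Function.uncurry F'))
    (h : ∀ z y, HasDerivAt (F z) (F' z y) y) (k l s : ℝ) :
    let G : ℝ × ℝ → ℝ := fun x => ∫ z in (k * (x.2 + s * x.1) + l)..x.1, F z (x.2 + s * x.1)
    ContDiff ℝ 1 G ∧ (∀ x, fderiv ℝ G x (1, -s) = F x.1 (x.2 + s * x.1)) ∧
      ∀ x, fderiv ℝ G x (0, 1) =
        -(k * F (k * (x.2 + s * x.1) + l) (x.2 + s * x.1)) +
          ∫ z in (k * (x.2 + s * x.1) + l)..x.1, F' z (x.2 + s * x.1) := by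
  intro G
  -- In the coordinates `(z, y)` the partial derivatives are explicit.
  let Q : ℝ → ℝ → ℝ := fun z y => ∫ ζ in (k * y + l)..z, F ζ y
  let Q₂ : ℝ × ℝ → ℝ := fun x => -(k * F (k * x.2 + l) x.2) + ∫ ζ in (k * x.2 + l)..x.1, F' ζ x.2
  have h1 (z y : ℝ) : HasDerivAt (fun z' => Q z' y) (Function.uncurry F (z, y)) z :=
    (Continuous.integral_hasStrictDerivAt
      (hF.comp (by fun_prop : Continuous fun z : ℝ => (z, y))) _ z).hasDerivAt
  have h2 (z y : ℝ) : HasDerivAt (fun y' => Q z y') (Q₂ (z, y)) y :=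
    hasDerivAt_integral_affine_left hF hF' h k l z y
  have c2 : Continuous Q₂ := by
    have e1 : Continuous fun x : ℝ × ℝ => F (k * x.2 + l) x.2 :=
      hF.comp (by fun_prop : Continuous fun x : ℝ × ℝ => (k * x.2 + l, x.2))
    refine (continuous_const.mul e1).neg.add ?_
    exact continuous_integral_endpoints (f := fun (x : ℝ × ℝ) z => F' z x.2)
      (hF'.comp (by fun_prop : Continuous fun q : (ℝ × ℝ) × ℝ => (q.2, q.1.2)))
      (by fun_prop) continuous_fst
  let A : ℝ × ℝ →L[ℝ] ℝ × ℝ := (ContinuousLinearMap.fst ℝ ℝ ℝ).prod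
    (ContinuousLinearMap.snd ℝ ℝ ℝ + s • ContinuousLinearMap.fst ℝ ℝ ℝ)
  have hd (x : ℝ × ℝ) := (hasFDerivAt_of_partials h1 h2 hF c2 (A x)).comp x A.hasFDerivAt
  refine ⟨(contDiff_one_of_partials h1 h2 hF c2).comp A.contDiff, fun x => ?_, fun x => ?_⟩
  · rw [HasFDerivAt.fderiv (f := G) (hd x)]
    simp [A, Function.uncurry]
  · rw [HasFDerivAt.fderiv (f := G) (hd x)]
    simp [A, Q₂]

/-- A kernel that decays like `exp (-l |b - z|)` has integral at most `C / l`, whatever the other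
end point is. -/
theorem abs_integral_le_of_exp_decay {f : ℝ → ℝ} {C l a b : ℝ} (hC : 0 ≤ C) (hl : 0 < l)
    (h : ∀ z ∈ uIcc a b, |f z| ≤ C * Real.exp (-(l * |b - z|))) :
    |∫ z in a..b, f z| ≤ C / l := by
  rcases le_total a b with hab | hab
  · have hg : ∀ z, HasDerivAt (fun z => C / l * Real.exp (-(l * (b - z))))
        (C * Real.exp (-(l * (b - z)))) z := fun z => by
      have h1 : HasDerivAt (fun z => -(l * (b - z))) l z := by
        exact (((hasDerivAt_id z).const_sub b).const_mul l).neg.congr_deriv (by simp)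
      refine (h1.exp.const_mul (C / l)).congr_deriv ?_
      field_simp
    have e := intervalIntegral.integral_eq_sub_of_hasDerivAt (a := a) (b := b)
      (fun z _ => hg z) (Continuous.intervalIntegrable (by fun_prop) _ _)
    have hle := intervalIntegral.norm_integral_le_of_norm_le (μ := volume) hab (f := f)
      (g := fun z => C * Real.exp (-(l * (b - z))))
      (Eventually.of_forall fun z hz => by
        have hz' : z ∈ uIcc a b := by rw [uIcc_of_le hab]; exact ⟨hz.1.le, hz.2⟩
        simpa [abs_of_nonneg (sub_nonneg.2 hz.2)] using h z hz')
      (Continuous.intervalIntegrable (by fun_prop) _ _)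
    rw [e] at hle
    refine (Real.norm_eq_abs _ ▸ hle).trans ?_
    have : 0 ≤ C / l * Real.exp (-(l * (b - a))) := by positivity
    simpa using this
  · have hg : ∀ z, HasDerivAt (fun z => -(C / l) * Real.exp (-(l * (z - b))))
        (C * Real.exp (-(l * (z - b)))) z := fun z => by
      have h1 : HasDerivAt (fun z => -(l * (z - b))) (-l) z := by
        exact (((hasDerivAt_id z).sub_const b).const_mul l).neg.congr_deriv (by simp)
      refine (h1.exp.const_mul (-(C / l))).congr_deriv ?_
      field_simp
    have e := intervalIntegral.integral_eq_sub_of_hasDerivAt (a := b) (b := a)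
      (fun z _ => hg z) (Continuous.intervalIntegrable (by fun_prop) _ _)
    have hle := intervalIntegral.norm_integral_le_of_norm_le (μ := volume) hab (f := f)
      (g := fun z => C * Real.exp (-(l * (z - b))))
      (Eventually.of_forall fun z hz => by
        have hz' : z ∈ uIcc a b := by rw [uIcc_of_ge hab]; exact ⟨hz.1.le, hz.2⟩
        simpa [abs_of_nonpos (sub_nonpos.2 hz.1.le)] using h z hz')
      (Continuous.intervalIntegrable (by fun_prop) _ _)
    rw [e] at hle
    rw [intervalIntegral.integral_symm, abs_neg]
    refine (Real.norm_eq_abs _ ▸ hle).trans ?_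
    have : 0 ≤ C / l * Real.exp (-(l * (a - b))) := by positivity
    simp
    linarith

/-! ### Linear systems integrated along straight characteristics -/

/-- The data of a linear system of integral equations in the plane,
`u i x = a i x + ∫ z in e i y..x.1, β z * T (u (z, y - s i * z)) i` with `y = x.2 + s i * x.1`.
The line `z ↦ (z, y - s i * z)` is the characteristic of the `i`-th equation with label `y`, and
the integration along it starts at the affine function `e i y = k i * y + r i` of the label. -/
structure CharSystem (ι : Type*) [Fintype ι] where
  /-- the zero order coupling -/
  T : (ι → ℝ) →L[ℝ] (ι → ℝ)
  /-- the scalar factor of the coupling, which depends on the first variable only -/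
  β : ℝ → ℝ
  /-- the slopes of the characteristics -/
  s : ι → ℝ
  /-- the slopes of the starting points, as functions of the label -/
  k : ι → ℝ
  /-- the constant terms of the starting points -/
  r : ι → ℝ

namespace CharSystem

open BoundedContinuousFunction

variable {ι : Type*} [Fintype ι] (S : CharSystem ι)

/-- The integrand of the `i`-th equation, on the characteristic with label `y`. -/
noncomputable def src (w : ℝ × ℝ → ι → ℝ) (i : ι) (z y : ℝ) : ℝ :=
  S.β z * S.T (w (z, y - S.s i * z)) i

/-- The label of the `i`-th characteristic through the point `x`. -/
def label (i : ι) (x : ℝ × ℝ) : ℝ := x.2 + S.s i * x.1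

/-- The starting point of the integration on the `i`-th characteristic with label `y`. -/
def start (i : ι) (y : ℝ) : ℝ := S.k i * y + S.r i

/-- The integral operator of the system. -/
noncomputable def op (w : ℝ × ℝ → ι → ℝ) (x : ℝ × ℝ) (i : ι) : ℝ :=
  ∫ z in (S.start i (S.label i x))..x.1, S.src w i z (S.label i x)

/-- The boundary term that appears when `op w` is differentiated in the second variable. -/
noncomputable def bdry (w : ℝ × ℝ → ι → ℝ) (x : ℝ × ℝ) (i : ι) : ℝ :=
  S.k i * S.src w i (S.start i (S.label i x)) (S.label i x)

/-- `W` is a weight for which the system is of Volterra type: it decreases at least at unit rate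
from a point towards the points whose values enter the equations at that point. -/
structure IsVolterraWeight (b : ℝ) (W : ℝ × ℝ → ℝ) : Prop where
  continuous_coeff : Continuous S.β
  abs_coeff_le : ∀ z, |S.β z| ≤ b
  continuous_weight : Continuous W
  weight_add_le : ∀ i x, ∀ z ∈ uIcc (S.start i (S.label i x)) x.1, S.β z ≠ 0 →
    W (z, S.label i x - S.s i * z) + |x.1 - z| ≤ W x

variable {S} {b : ℝ} {W : ℝ × ℝ → ℝ}

@[fun_prop]
theorem continuous_src (hβ : Continuous S.β) {w : ℝ × ℝ → ι → ℝ} (hw : Continuous w) (i : ι) :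
    Continuous (Function.uncurry (S.src w i)) := by
  have h : Continuous fun p : ℝ × ℝ => S.T (w (p.1, p.2 - S.s i * p.1)) :=
    S.T.continuous.comp (hw.comp (by fun_prop))
  exact (hβ.comp continuous_fst).mul ((continuous_apply i).comp h)

theorem continuous_label (i : ι) : Continuous (S.label i) := by
  unfold label; fun_prop

theorem continuous_start (i : ι) : Continuous (S.start i) := by
  unfold start; fun_prop

theorem continuous_op (hβ : Continuous S.β) {w : ℝ × ℝ → ι → ℝ} (hw : Continuous w) :
    Continuous (S.op w) := by
  refine continuous_pi fun i => ?_
  refine continuous_integral_endpoints (f := fun x z => S.src w i z (S.label i x)) ?_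
    ((continuous_start i).comp (continuous_label i)) continuous_fst
  exact (continuous_src hβ hw i).comp
    (continuous_snd.prodMk ((continuous_label i).comp continuous_fst))

theorem continuous_bdry (hβ : Continuous S.β) {w : ℝ × ℝ → ι → ℝ} (hw : Continuous w) :
    Continuous (S.bdry w) := by
  refine continuous_pi fun i => continuous_const.mul ?_
  exact (continuous_src hβ hw i).comp
    (((continuous_start i).comp (continuous_label i)).prodMk (continuous_label i))

theorem src_add (v w : ℝ × ℝ → ι → ℝ) (i : ι) (z y : ℝ) :
    S.src (v + w) i z y = S.src v i z y + S.src w i z y := by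
  simp [src, mul_add]

theorem src_smul (c : ℝ) (w : ℝ × ℝ → ι → ℝ) (i : ι) (z y : ℝ) :
    S.src (c • w) i z y = c * S.src w i z y := by
  simp only [src, Pi.smul_apply, map_smul, smul_eq_mul]
  ring

theorem op_add (hβ : Continuous S.β) {v w : ℝ × ℝ → ι → ℝ} (hv : Continuous v)
    (hw : Continuous w) : S.op (v + w) = S.op v + S.op w := by
  have hi {w : ℝ × ℝ → ι → ℝ} (hw : Continuous w) (i : ι) (y : ℝ) :
      Continuous fun z => S.src w i z y :=
    (continuous_src hβ hw i).comp (by fun_prop : Continuous fun z : ℝ => (z, y))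
  ext x i
  simp only [op, src_add, Pi.add_apply]
  exact intervalIntegral.integral_add ((hi hv i _).intervalIntegrable _ _)
    ((hi hw i _).intervalIntegrable _ _)

theorem op_smul (c : ℝ) (w : ℝ × ℝ → ι → ℝ) : S.op (c • w) = c • S.op w := by
  ext x i
  simp [op, src_smul]

theorem bdry_add (v w : ℝ × ℝ → ι → ℝ) : S.bdry (v + w) = S.bdry v + S.bdry w := by
  ext x i
  simp [bdry, src_add, mul_add]

theorem bdry_smul (c : ℝ) (w : ℝ × ℝ → ι → ℝ) : S.bdry (c • w) = c • S.bdry w := by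
  ext x i
  simp only [bdry, src_smul, Pi.smul_apply, smul_eq_mul]
  ring

theorem IsVolterraWeight.bound_nonneg (h : S.IsVolterraWeight b W) : 0 ≤ b :=
  (abs_nonneg _).trans (h.abs_coeff_le 0)

theorem abs_src_le (h : S.IsVolterraWeight b W) {l C : ℝ} (hl : 0 < l) (hC : 0 ≤ C)
    {w : ℝ × ℝ → ι → ℝ} (hw : ∀ x, ‖w x‖ ≤ C * Real.exp (l * W x)) (i : ι) (x : ℝ × ℝ) {z : ℝ}
    (hz : z ∈ uIcc (S.start i (S.label i x)) x.1) :
    |S.src w i z (S.label i x)| ≤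
      b * ‖S.T‖ * C * Real.exp (l * W x) * Real.exp (-(l * |x.1 - z|)) := by
  have hb := h.bound_nonneg
  by_cases h0 : S.β z = 0
  · rw [src, h0, zero_mul, abs_zero]
    positivity
  have hW := h.weight_add_le i x z hz h0
  set p := (z, S.label i x - S.s i * z)
  calc |S.src w i z (S.label i x)| = |S.β z| * |S.T (w p) i| := abs_mul _ _
    _ ≤ b * (‖S.T‖ * (C * Real.exp (l * W p))) := by
        refine mul_le_mul (h.abs_coeff_le z) ?_ (abs_nonneg _) hb
        calc |S.T (w p) i| ≤ ‖S.T (w p)‖ := norm_le_pi_norm (S.T (w p)) i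
          _ ≤ ‖S.T‖ * ‖w p‖ := S.T.le_opNorm _
          _ ≤ _ := by gcongr; exact hw p
    _ ≤ b * (‖S.T‖ * (C * (Real.exp (l * W x) * Real.exp (-(l * |x.1 - z|))))) := by
        rw [← Real.exp_add]
        gcongr
        nlinarith
    _ = _ := by ring

theorem abs_op_le (h : S.IsVolterraWeight b W) {l C : ℝ} (hl : 0 < l) (hC : 0 ≤ C)
    {w : ℝ × ℝ → ι → ℝ} (hw : ∀ x, ‖w x‖ ≤ C * Real.exp (l * W x)) (x : ℝ × ℝ) (i : ι) :
    |S.op w x i| ≤ b * ‖S.T‖ / l * C * Real.exp (l * W x) := by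
  have hb := h.bound_nonneg
  refine (abs_integral_le_of_exp_decay (C := b * ‖S.T‖ * C * Real.exp (l * W x)) (by positivity) hl
    fun z hz => abs_src_le h hl hC hw i x hz).trans_eq ?_
  ring

theorem abs_bdry_le (h : S.IsVolterraWeight b W) {l C : ℝ} (hl : 0 < l) (hC : 0 ≤ C)
    {w : ℝ × ℝ → ι → ℝ} (hw : ∀ x, ‖w x‖ ≤ C * Real.exp (l * W x)) (x : ℝ × ℝ) (i : ι) :
    |S.bdry w x i| ≤ ‖S.k‖ * (b * ‖S.T‖) * C * Real.exp (l * W x) := by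
  have hb := h.bound_nonneg
  have h1 := abs_src_le h hl hC hw i x (z := S.start i (S.label i x)) left_mem_uIcc
  rw [bdry, abs_mul]
  calc |S.k i| * _ ≤ ‖S.k‖ * (b * ‖S.T‖ * C * Real.exp (l * W x) * 1) := by
        refine mul_le_mul (norm_le_pi_norm S.k i) (h1.trans ?_) (abs_nonneg _) (norm_nonneg _)
        gcongr
        simpa using (by positivity : 0 ≤ l * |x.1 - S.start i (S.label i x)|)
    _ = _ := by ring

/-- The function of exponential growth `exp (l * W)` that corresponds to a bounded function. -/
noncomputable def grow (l : ℝ) (W : ℝ × ℝ → ℝ) (v : (ℝ × ℝ) →ᵇ (ι → ℝ)) : ℝ × ℝ → ι → ℝ :=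
  fun x => Real.exp (l * W x) • v x

theorem continuous_grow (hW : Continuous W) (l : ℝ) (v : (ℝ × ℝ) →ᵇ (ι → ℝ)) :
    Continuous (grow l W v) := by
  have := v.continuous
  unfold grow
  fun_prop

theorem norm_grow_le (l : ℝ) (v : (ℝ × ℝ) →ᵇ (ι → ℝ)) (x : ℝ × ℝ) :
    ‖grow l W v x‖ ≤ ‖v‖ * Real.exp (l * W x) := by
  rw [grow, norm_smul, Real.norm_of_nonneg (Real.exp_pos _).le, mul_comm]
  gcongr
  exact v.norm_coe_le_norm x

theorem grow_add (l : ℝ) (v w : (ℝ × ℝ) →ᵇ (ι → ℝ)) :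
    grow l W (v + w) = grow l W v + grow l W w := by
  ext x i; simp [grow, mul_add]

theorem grow_smul (l c : ℝ) (v : (ℝ × ℝ) →ᵇ (ι → ℝ)) :
    grow l W (c • v) = c • grow l W v := by
  ext x i; simp only [grow, coe_smul, Pi.smul_apply, smul_eq_mul]; ring

/-- A linear operator on functions of growth `exp (l * W)`, conjugated to an operator on bounded
functions. -/
noncomputable def conj (l : ℝ) (hW : Continuous W) (O : (ℝ × ℝ → ι → ℝ) → (ℝ × ℝ → ι → ℝ)) (M : ℝ)
    (hM : 0 ≤ M) (hc : ∀ w, Continuous w → Continuous (O w))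
    (ha : ∀ v w, Continuous v → Continuous w → O (v + w) = O v + O w)
    (hs : ∀ (c : ℝ) w, O (c • w) = c • O w)
    (hO : ∀ (w : ℝ × ℝ → ι → ℝ) (C : ℝ), 0 ≤ C → (∀ x, ‖w x‖ ≤ C * Real.exp (l * W x)) →
      ∀ x i, |O w x i| ≤ M * C * Real.exp (l * W x)) :
    ((ℝ × ℝ) →ᵇ (ι → ℝ)) →L[ℝ] ((ℝ × ℝ) →ᵇ (ι → ℝ)) :=
  have hbound (v : (ℝ × ℝ) →ᵇ (ι → ℝ)) (x : ℝ × ℝ) :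
      ‖Real.exp (-(l * W x)) • O (grow l W v) x‖ ≤ M * ‖v‖ := by
    rw [pi_norm_le_iff_of_nonneg (by positivity)]
    intro i
    have := hO _ _ (norm_nonneg v) (norm_grow_le l v) x i
    rw [Pi.smul_apply, smul_eq_mul, norm_mul, Real.norm_of_nonneg (Real.exp_pos _).le,
      Real.exp_neg, inv_mul_le_iff₀ (Real.exp_pos _), mul_comm]
    exact this
  LinearMap.mkContinuous
    { toFun := fun v => ofNormedAddCommGroup (fun x => Real.exp (-(l * W x)) • O (grow l W v) x)
        (by
          have := hc _ (continuous_grow hW l v)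
          fun_prop) (M * ‖v‖) (hbound v)
      map_add' := fun v w => by
        ext x i
        simp [grow_add, ha _ _ (continuous_grow hW l v) (continuous_grow hW l w)]
      map_smul' := fun c v => by
        ext x i
        simp only [grow_smul, hs, coe_ofNormedAddCommGroup, Pi.smul_apply, smul_eq_mul,
          RingHom.id_apply, coe_smul]
        ring }
    M (fun v => by
      rw [LinearMap.coe_mk, AddHom.coe_mk]
      exact norm_ofNormedAddCommGroup_le _ (by positivity) (hbound v))

theorem norm_conj_le (l : ℝ) (hW : Continuous W) (O : (ℝ × ℝ → ι → ℝ) → (ℝ × ℝ → ι → ℝ)) (M : ℝ)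
    (hM : 0 ≤ M) (hc ha hs hO) : ‖conj l hW O M hM hc ha hs hO‖ ≤ M := by
  unfold conj
  exact LinearMap.mkContinuous_norm_le _ hM _

theorem grow_conj (l : ℝ) (hW : Continuous W) (O : (ℝ × ℝ → ι → ℝ) → (ℝ × ℝ → ι → ℝ)) (M : ℝ)
    (hM : 0 ≤ M) (hc ha hs hO) (v) :
    grow l W (conj l hW O M hM hc ha hs hO v) = O (grow l W v) := by
  ext x i
  change Real.exp (l * W x) * (Real.exp (-(l * W x)) * O (grow l W v) x i) = _
  rw [← mul_assoc, ← Real.exp_add]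
  simp

/-- The data `a` of the system, with derivative `a'` in the second variable, is bounded. -/
structure IsBoundedData (a a' : ℝ × ℝ → ι → ℝ) (C : ℝ) : Prop where
  continuous_data : Continuous a
  continuous_deriv : Continuous a'
  hasDerivAt : ∀ z t i, HasDerivAt (fun t' => a (z, t') i) (a' (z, t) i) t
  norm_data_le : ∀ x, ‖a x‖ ≤ C
  norm_deriv_le : ∀ x, ‖a' x‖ ≤ C

/-- On `V` the data vanish, and the values of the unknown outside of `V` do not enter the equations
at the points of `V`. -/
structure IsQuiet (S : CharSystem ι) (a a' : ℝ × ℝ → ι → ℝ) (V : Set (ℝ × ℝ)) : Prop where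
  data_eq_zero : ∀ x ∈ V, a x = 0
  deriv_eq_zero : ∀ x ∈ V, a' x = 0
  mem_of_mem : ∀ i, ∀ x ∈ V, ∀ z ∈ uIcc (S.start i (S.label i x)) x.1,
    S.β z = 0 ∨ (z, S.label i x - S.s i * z) ∈ V

theorem IsQuiet.src_eq_zero {a a' : ℝ × ℝ → ι → ℝ} {V : Set (ℝ × ℝ)} (hV : S.IsQuiet a a' V)
    {w : ℝ × ℝ → ι → ℝ} (hw : ∀ x ∈ V, w x = 0) {x : ℝ × ℝ} (hx : x ∈ V) (i : ι) {z : ℝ}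
    (hz : z ∈ uIcc (S.start i (S.label i x)) x.1) : S.src w i z (S.label i x) = 0 := by
  rcases hV.mem_of_mem i x hx z hz with h | h
  · simp [src, h]
  · simp [src, hw _ h]

theorem IsQuiet.op_eq_zero {a a' : ℝ × ℝ → ι → ℝ} {V : Set (ℝ × ℝ)} (hV : S.IsQuiet a a' V)
    {w : ℝ × ℝ → ι → ℝ} (hw : ∀ x ∈ V, w x = 0) {x : ℝ × ℝ} (hx : x ∈ V) : S.op w x = 0 := by
  ext i
  rw [op, intervalIntegral.integral_congr (g := fun _ => 0)
    fun z hz => hV.src_eq_zero hw hx i hz]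
  simp

theorem IsQuiet.bdry_eq_zero {a a' : ℝ × ℝ → ι → ℝ} {V : Set (ℝ × ℝ)} (hV : S.IsQuiet a a' V)
    {w : ℝ × ℝ → ι → ℝ} (hw : ∀ x ∈ V, w x = 0) {x : ℝ × ℝ} (hx : x ∈ V) : S.bdry w x = 0 := by
  ext i
  rw [bdry, hV.src_eq_zero hw hx i left_mem_uIcc]
  simp

theorem hasDerivAt_src {u p : ℝ × ℝ → ι → ℝ}
    (h : ∀ z t i, HasDerivAt (fun t' => u (z, t') i) (p (z, t) i) t) (i : ι) (z y : ℝ) :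
    HasDerivAt (S.src u i z) (S.src p i z y) y := by
  have h1 : HasDerivAt (fun t => u (z, t)) (p (z, y - S.s i * z)) (y - S.s i * z) :=
    hasDerivAt_pi.2 fun i => h z _ i
  have h2 : HasDerivAt (fun y => u (z, y - S.s i * z)) (p (z, y - S.s i * z)) y := by
    exact (HasDerivAt.scomp y h1 ((hasDerivAt_id y).sub_const (S.s i * z))).congr_deriv
      (one_smul ℝ _)
  have h3 := hasDerivAt_pi.1 (S.T.hasFDerivAt.comp_hasDerivAt y h2) i
  exact h3.const_mul (S.β z)

/-- The integral operator, differentiated in the second variable. -/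
theorem hasDerivAt_op (hβ : Continuous S.β) {u p : ℝ × ℝ → ι → ℝ} (hu : Continuous u)
    (hp : Continuous p) (h : ∀ z t i, HasDerivAt (fun t' => u (z, t') i) (p (z, t) i) t)
    (z t : ℝ) (i : ι) :
    HasDerivAt (fun t' => S.op u (z, t') i) (-S.bdry u (z, t) i + S.op p (z, t) i) t := by
  have h1 := hasDerivAt_integral_affine_left (continuous_src hβ hu i) (continuous_src hβ hp i)
    (fun z y => hasDerivAt_src h i z y) (S.k i) (S.r i) z (t + S.s i * z)
  have h2 : HasDerivAt (fun t' : ℝ => t' + S.s i * z) 1 t := (hasDerivAt_id t).add_const _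
  exact (HasDerivAt.scomp t h1 h2).congr_deriv (one_smul _ _)

/-- Existence of a solution that has a continuous derivative in the second variable. The solution
and its derivative are found together, as the fixed point of a contraction: differentiated
equations have the same integral operator, and the boundary terms, which involve the solution
only, are made small by the factor `1 / L`. -/
theorem exists_solution_hasDerivAt (h : S.IsVolterraWeight b W) {a a' : ℝ × ℝ → ι → ℝ} {C : ℝ}
    (ha : IsBoundedData a a' C) {V : Set (ℝ × ℝ)} (hV : S.IsQuiet a a' V)
    (hWV : ∀ x, W x < 0 → x ∈ V) :
    ∃ u p : ℝ × ℝ → ι → ℝ, Continuous u ∧ Continuous p ∧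
      (∀ z t i, HasDerivAt (fun t' => u (z, t') i) (p (z, t) i) t) ∧
      (∀ x, u x = a x + S.op u x) ∧ ∀ x ∈ V, u x = 0 := by
  have hb := h.bound_nonneg
  have hW := h.continuous_weight
  have hβ := h.continuous_coeff
  have hC : 0 ≤ C := (norm_nonneg _).trans (ha.norm_data_le 0)
  obtain ⟨l, hl, hl4⟩ : ∃ l : ℝ, 0 < l ∧ b * ‖S.T‖ / l ≤ 1 / 4 := by
    refine ⟨4 * (b * ‖S.T‖) + 1, by positivity, ?_⟩
    rw [div_le_iff₀ (by positivity)]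
    linarith
  obtain ⟨L, hL, hL4⟩ : ∃ L : ℝ, 0 < L ∧ L⁻¹ * (‖S.k‖ * (b * ‖S.T‖)) ≤ 1 / 4 := by
    refine ⟨4 * (‖S.k‖ * (b * ‖S.T‖)) + 1, by positivity, ?_⟩
    rw [inv_mul_le_iff₀ (by positivity)]
    linarith
  let K := conj l hW S.op (b * ‖S.T‖ / l) (by positivity) (fun w => continuous_op hβ)
    (fun v w => op_add hβ) op_smul (fun w C hC hw => abs_op_le h hl hC hw)
  let R := conj l hW S.bdry (‖S.k‖ * (b * ‖S.T‖)) (by positivity) (fun w => continuous_bdry hβ)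
    (fun v w _ _ => bdry_add v w) bdry_smul (fun w C hC hw => abs_bdry_le h hl hC hw)
  have hK : ‖K‖ ≤ 1 / 4 := (norm_conj_le ..).trans hl4
  have hR : ‖R‖ ≤ ‖S.k‖ * (b * ‖S.T‖) := norm_conj_le ..
  have hbd {f : ℝ × ℝ → ι → ℝ} (hfC : ∀ x, ‖f x‖ ≤ C) (hfV : ∀ x ∈ V, f x = 0) (x : ℝ × ℝ) :
      ‖Real.exp (-(l * W x)) • f x‖ ≤ C := by
    rw [norm_smul, Real.norm_of_nonneg (Real.exp_pos _).le]
    by_cases hx : W x < 0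
    · simp [hfV x (hWV x hx), hC]
    · calc _ ≤ 1 * C := by
            gcongr
            · simp only [Real.exp_le_one_iff, Left.neg_nonpos_iff]
              have := not_lt.1 hx
              positivity
            · exact hfC x
        _ = C := one_mul _
  have := ha.continuous_data
  have := ha.continuous_deriv
  let v₀ : (ℝ × ℝ) →ᵇ (ι → ℝ) := ofNormedAddCommGroup (fun x => Real.exp (-(l * W x)) • a x)
    (by fun_prop) C (hbd ha.norm_data_le hV.data_eq_zero)
  let q₀ : (ℝ × ℝ) →ᵇ (ι → ℝ) := ofNormedAddCommGroup (fun x => Real.exp (-(l * W x)) • a' x)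
    (by fun_prop) C (hbd ha.norm_deriv_le hV.deriv_eq_zero)
  have hg {f : ℝ × ℝ → ι → ℝ} (x : ℝ × ℝ) :
      Real.exp (l * W x) • (Real.exp (-(l * W x)) • f x) = f x := by
    rw [smul_smul, ← Real.exp_add]; simp
  have gv₀ : grow l W v₀ = a := funext fun x => hg x
  have gq₀ : grow l W q₀ = a' := funext fun x => hg x
  have gK (v) : grow l W (K v) = S.op (grow l W v) := grow_conj ..
  have gR (v) : grow l W (R v) = S.bdry (grow l W v) := grow_conj ..
  -- The unknowns are `u = grow v` and `∂ₜ u = L • grow q`.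
  let E := (ℝ × ℝ) →ᵇ (ι → ℝ)
  let Φ : E × E → E × E := fun x => (v₀ + K x.1, L⁻¹ • (q₀ - R x.1) + K x.2)
  have hΦ : ContractingWith (1 / 2) Φ := by
    refine ⟨by norm_num, LipschitzWith.of_dist_le_mul fun x y => ?_⟩
    have e1 : dist x.1 y.1 ≤ dist x y := le_max_left _ _
    have e2 : dist x.2 y.2 ≤ dist x y := le_max_right _ _
    rw [dist_eq_norm] at e1 e2
    have f1 : ‖K (x.1 - y.1)‖ ≤ 1 / 4 * ‖x.1 - y.1‖ := K.le_of_opNorm_le hK _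
    have f2 : ‖K (x.2 - y.2)‖ ≤ 1 / 4 * ‖x.2 - y.2‖ := K.le_of_opNorm_le hK _
    have f3 : ‖L⁻¹ • R (x.1 - y.1)‖ ≤ 1 / 4 * ‖x.1 - y.1‖ := by
      rw [norm_smul, Real.norm_of_nonneg (by positivity)]
      calc L⁻¹ * ‖R (x.1 - y.1)‖ ≤ L⁻¹ * (‖S.k‖ * (b * ‖S.T‖) * ‖x.1 - y.1‖) := by
            gcongr
            exact R.le_of_opNorm_le hR _
        _ = L⁻¹ * (‖S.k‖ * (b * ‖S.T‖)) * ‖x.1 - y.1‖ := by ring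
        _ ≤ _ := by gcongr
    have hd : (0 : ℝ) ≤ dist x y := dist_nonneg
    have hc : ((1 / 2 : NNReal) : ℝ) = 1 / 2 := by simp
    rw [hc]
    refine max_le ?_ ?_
    · change dist (v₀ + K x.1) (v₀ + K y.1) ≤ _
      rw [dist_add_left, dist_eq_norm, ← map_sub]
      linarith
    · change dist (L⁻¹ • (q₀ - R x.1) + K x.2) (L⁻¹ • (q₀ - R y.1) + K y.2) ≤ _
      rw [dist_eq_norm]
      have : L⁻¹ • (q₀ - R x.1) + K x.2 - (L⁻¹ • (q₀ - R y.1) + K y.2)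
          = K (x.2 - y.2) - L⁻¹ • R (x.1 - y.1) := by
        rw [map_sub, map_sub, smul_sub, smul_sub, smul_sub]; abel
      rw [this]
      refine (norm_sub_le _ _).trans ?_
      linarith
  -- The closed set of pairs that vanish on `V` and whose second entry represents the derivative of
  -- the first.
  let I₁ : Set (E × E) := {x | ∀ z t i, grow l W x.1 (z, t) i - grow l W x.1 (z, 0) i =
    ∫ t' in (0 : ℝ)..t, L * grow l W x.2 (z, t') i}
  let I₂ : Set (E × E) := {x | ∀ y ∈ V, x.1 y = 0 ∧ x.2 y = 0}
  let I : Set (E × E) := I₁ ∩ I₂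
  have ev (y : ℝ × ℝ) : Continuous fun x : E => x y := continuous_eval_const y
  have hI : IsClosed I := by
    refine IsClosed.inter ?_ ?_
    · simp only [I₁, ofPred_forall]
      refine isClosed_iInter fun z => isClosed_iInter fun t => isClosed_iInter fun i =>
        isClosed_eq ?_ ?_
      · have e1 := (ev (z, t)).comp (continuous_fst (X := E) (Y := E))
        have e2 := (ev (z, 0)).comp (continuous_fst (X := E) (Y := E))
        exact ((continuous_apply i).comp (e1.const_smul (Real.exp (l * W (z, t))))).sub
          ((continuous_apply i).comp (e2.const_smul (Real.exp (l * W (z, 0)))))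
      · refine intervalIntegral.continuous_parametric_intervalIntegral_of_continuous
          (f := fun (x : E × E) t' => L * grow l W x.2 (z, t') i) ?_ continuous_const
        have e1 : Continuous fun x : (E × E) × ℝ => x.1.2 (z, x.2) :=
          (continuous_eval (F := E) (X := ℝ × ℝ)).comp (by fun_prop :
            Continuous fun x : (E × E) × ℝ => (x.1.2, ((z, x.2) : ℝ × ℝ)))
        have e2 : Continuous fun x : (E × E) × ℝ => Real.exp (l * W (z, x.2)) := by fun_prop
        exact continuous_const.mul ((continuous_apply i).comp (e2.smul e1))
    · simp only [I₂, ofPred_forall]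
      refine isClosed_iInter fun y => isClosed_iInter fun _ => ?_
      exact (isClosed_eq ((ev y).comp continuous_fst) continuous_const).inter
        (isClosed_eq ((ev y).comp continuous_snd) continuous_const)
  have cg (v : E) := continuous_grow (ι := ι) hW l v
  have cgi (v : E) (z : ℝ) (i : ι) : Continuous fun t => grow l W v (z, t) i :=
    (continuous_apply i).comp ((cg v).comp (by fun_prop))
  have hdI {x : E × E} (hx : x ∈ I) (z t : ℝ) (i : ι) :
      HasDerivAt (fun t' => grow l W x.1 (z, t') i) ((L • grow l W x.2) (z, t) i) t := by
    have e : (fun t' => grow l W x.1 (z, t') i) = fun t' => grow l W x.1 (z, 0) i +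
        ∫ t' in (0 : ℝ)..t', L * grow l W x.2 (z, t') i := by
      ext t'; rw [← hx.1 z t' i]; ring
    rw [e]
    have := cgi x.2 z i
    exact (Continuous.integral_hasStrictDerivAt (by fun_prop) 0 t).hasDerivAt.const_add _
  have hv {v : E} {y : ℝ × ℝ} : v y = 0 ↔ grow l W v y = 0 := by
    rw [grow, smul_eq_zero, or_iff_right (Real.exp_pos _).ne']
  have gΦ1 (x : E × E) : grow l W (Φ x).1 = a + S.op (grow l W x.1) := by
    change grow l W (v₀ + K x.1) = _
    rw [grow_add, gv₀, gK]
  have gΦ2 (x : E × E) : L • grow l W (Φ x).2 =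
      a' - S.bdry (grow l W x.1) + S.op (L • grow l W x.2) := by
    change L • grow l W (L⁻¹ • (q₀ - R x.1) + K x.2) = _
    rw [grow_add, gK, grow_smul, op_smul, smul_add, smul_inv_smul₀ hL.ne', sub_eq_add_neg,
      ← neg_one_smul ℝ (R x.1), grow_add, grow_smul, gR, gq₀, neg_one_smul, ← sub_eq_add_neg]
  have hΦI : MapsTo Φ I I := by
    intro x hx
    refine ⟨fun z t i => ?_, fun y hy => ?_⟩
    · have hd (t : ℝ) : HasDerivAt (fun t' => grow l W (Φ x).1 (z, t') i)
          ((L • grow l W (Φ x).2) (z, t) i) t := by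
        rw [gΦ1, gΦ2]
        refine ((ha.hasDerivAt z t i).add (hasDerivAt_op hβ (cg x.1)
          ((cg x.2).const_smul L) (hdI hx) z t i)).congr_deriv ?_
        simp only [Pi.add_apply, Pi.sub_apply]
        ring
      have := cgi (Φ x).2 z i
      have := intervalIntegral.integral_eq_sub_of_hasDerivAt (a := 0) (b := t) (fun t _ => hd t)
        (Continuous.intervalIntegrable (by
          simp only [Pi.smul_apply, smul_eq_mul]; fun_prop) _ _)
      rw [← this]
      rfl
    · have z1 : ∀ y ∈ V, grow l W x.1 y = 0 := fun y hy => hv.1 (hx.2 y hy).1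
      have z2 : ∀ y ∈ V, (L • grow l W x.2) y = 0 := fun y hy => by
        rw [Pi.smul_apply, hv.1 (hx.2 y hy).2, smul_zero]
      constructor
      · rw [hv, gΦ1, Pi.add_apply, hV.data_eq_zero y hy, hV.op_eq_zero z1 hy, add_zero]
      · have : (L • grow l W (Φ x).2) y = 0 := by
          rw [gΦ2, Pi.add_apply, Pi.sub_apply, hV.deriv_eq_zero y hy, hV.op_eq_zero z2 hy,
            hV.bdry_eq_zero z1 hy, sub_zero, add_zero]
        rw [hv]
        rwa [Pi.smul_apply, smul_eq_zero, or_iff_right hL.ne'] at this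
  have h0 : (0 : E × E) ∈ I := ⟨fun z t i => by simp [grow], fun y _ => ⟨rfl, rfl⟩⟩
  set x := hΦ.fixedPoint Φ
  have hx : Φ x = x := hΦ.fixedPoint_isFixedPt
  have hxI : x ∈ I := hI.mem_of_tendsto (hΦ.tendsto_iterate_fixedPoint 0)
    (Eventually.of_forall fun n => hΦI.iterate n h0)
  refine ⟨grow l W x.1, L • grow l W x.2, cg _, (cg _).const_smul L, hdI hxI, fun y => ?_,
    fun y hy => hv.1 (hxI.2 y hy).1⟩
  conv_lhs => rw [← hx, gΦ1]
  rfl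

/-- Existence of a continuously differentiable solution of the integral equations, together with
the differential equations that it solves. -/
theorem exists_contDiff_solution (h : S.IsVolterraWeight b W) {a a' : ℝ × ℝ → ι → ℝ} {C : ℝ}
    (ha : IsBoundedData a a' C) (ha1 : ContDiff ℝ 1 a) {V : Set (ℝ × ℝ)} (hV : S.IsQuiet a a' V)
    (hWV : ∀ x, W x < 0 → x ∈ V) :
    ∃ u : ℝ × ℝ → ι → ℝ, ContDiff ℝ 1 u ∧ (∀ x, u x = a x + S.op u x) ∧ (∀ x ∈ V, u x = 0) ∧
      ∀ x i, fderiv ℝ u x (1, -S.s i) i = fderiv ℝ a x (1, -S.s i) i + S.β x.1 * S.T (u x) i := by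
  obtain ⟨u, p, hu, hp, hup, hfix, huV⟩ := exists_solution_hasDerivAt h ha hV hWV
  have hβ := h.continuous_coeff
  have hline (i : ι) := contDiff_integral_along_lines (continuous_src hβ hu i)
    (continuous_src hβ hp i) (fun z y => hasDerivAt_src hup i z y) (S.k i) (S.r i) (S.s i)
  have hop (i : ι) : ContDiff ℝ 1 (fun x => S.op u x i) := (hline i).1
  have hop' (i : ι) (x : ℝ × ℝ) : fderiv ℝ (fun x => S.op u x i) x (1, -S.s i) =
      S.src u i x.1 (S.label i x) := (hline i).2.1 x
  have hu' (i : ι) : (fun x => u x i) = (fun x => a x i) + fun x => S.op u x i :=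
    funext fun x => congrFun (hfix x) i
  have ha' (i : ι) : ContDiff ℝ 1 fun x => a x i := contDiff_pi.1 ha1 i
  have hu1 : ContDiff ℝ 1 u := by
    refine contDiff_pi.2 fun i => ?_
    rw [hu']
    exact (ha' i).add (hop i)
  refine ⟨u, hu1, hfix, huV, fun x i => ?_⟩
  have ap {w : ℝ × ℝ → ι → ℝ} (hw : ContDiff ℝ 1 w) (v : ℝ × ℝ) :
      fderiv ℝ w x v i = fderiv ℝ (fun x => w x i) x v := by
    have := hasFDerivAt_pi'.1 (hw.differentiable one_ne_zero x).hasFDerivAt i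
    rw [this.fderiv]
    rfl
  rw [ap hu1, ap ha1, hu', fderiv_add ((ha' i).differentiable one_ne_zero x)
    ((hop i).differentiable one_ne_zero x), _root_.add_apply, hop']
  simp [src, label]

end CharSystem

/-! ### Extension and truncation of the coefficient -/

theorem exists_contDiff_extension {Z : ℝ} (hZ : 0 < Z) {β : ℝ → ℝ}
    (hβ : ContDiffOn ℝ 1 β (Icc 0 Z)) :
    ∃ βe : ℝ → ℝ, ContDiff ℝ 1 βe ∧ EqOn βe β (Icc 0 Z) := by
  have hc : ContinuousOn (derivWithin β (Icc 0 Z)) (Icc 0 Z) :=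
    hβ.continuousOn_derivWithin (uniqueDiffOn_Icc hZ) le_rfl
  -- The derivative is extended by constants and integrated.
  let g : ℝ → ℝ := IccExtend hZ.le ((Icc 0 Z).domRestrict (derivWithin β (Icc 0 Z)))
  have hg : Continuous g := hc.domRestrict.Icc_extend'
  have hgd (z : ℝ) : HasDerivAt (fun z => β 0 + ∫ s in (0 : ℝ)..z, g s) (g z) z :=
    (hg.integral_hasStrictDerivAt 0 z).hasDerivAt.const_add _
  refine ⟨fun z => β 0 + ∫ s in (0 : ℝ)..z, g s, ?_, fun z hz => ?_⟩
  · rw [contDiff_one_iff_deriv]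
    refine ⟨fun z => (hgd z).differentiableAt, ?_⟩
    rwa [show deriv (fun z => β 0 + ∫ s in (0 : ℝ)..z, g s) = g from funext fun z => (hgd z).deriv]
  · have := intervalIntegral.integral_eq_sub_of_hasDerivAt_of_le (a := 0) (b := z) (f := β)
      (f' := g) hz.1 (hβ.continuousOn.mono (Icc_subset_Icc_right hz.2)) (fun s hs => ?_)
      (hg.intervalIntegrable _ _)
    · simp [this]
    · have hs' : s ∈ Icc 0 Z := ⟨hs.1.le, (hs.2.trans_le hz.2).le⟩
      have hn : Icc 0 Z ∈ 𝓝 s := Icc_mem_nhds hs.1 (hs.2.trans_le hz.2)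
      have hd := ((hβ.differentiableOn one_ne_zero) s hs').hasDerivWithinAt.hasDerivAt hn
      simpa [g, IccExtend_of_mem hZ.le _ hs'] using! hd

theorem exists_truncation {β : ℝ → ℝ} (hβ : ContDiff ℝ 1 β) (h0 : β 0 = 0) (h1 : deriv β 0 = 0)
    (R : ℝ) :
    ∃ βt : ℝ → ℝ, ContDiff ℝ 1 βt ∧ HasCompactSupport βt ∧ (∀ z ≤ 0, βt z = 0) ∧
      (∀ z, R + 1 ≤ z → βt z = 0) ∧ EqOn βt β (Icc 0 R) := by
  have hc : Continuous (deriv β) := hβ.continuous_deriv le_rfl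
  -- The truncation at `z = 0` is `C¹` because `β` and `β'` vanish there.
  let g : ℝ → ℝ := fun s => deriv β (max s 0)
  have hg : Continuous g := by fun_prop
  let f : ℝ → ℝ := fun z => ∫ s in (0 : ℝ)..z, g s
  have hfd (z : ℝ) : HasDerivAt f (g z) z := (hg.integral_hasStrictDerivAt 0 z).hasDerivAt
  have hf : ContDiff ℝ 1 f := by
    rw [contDiff_one_iff_deriv]
    refine ⟨fun z => (hfd z).differentiableAt, ?_⟩
    rwa [show deriv f = g from funext fun z => (hfd z).deriv]
  have hf0 (z : ℝ) (hz : z ≤ 0) : f z = 0 := by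
    simp only [f]
    rw [intervalIntegral.integral_congr (g := fun _ => 0)]
    · simp
    · intro s hs
      rw [uIcc_of_ge hz] at hs
      simp [g, max_eq_right hs.2, h1]
  have hfβ (z : ℝ) (hz : 0 ≤ z) : f z = β z := by
    have := intervalIntegral.integral_eq_sub_of_hasDerivAt (a := 0) (b := z) (f := β)
      (f' := deriv β) (fun s _ => (hβ.differentiable one_ne_zero s).hasDerivAt)
      (hc.intervalIntegrable _ _)
    rw [h0, sub_zero] at this
    rw [← this]
    refine intervalIntegral.integral_congr fun s hs => ?_
    rw [uIcc_of_le hz] at hs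
    simp [g, max_eq_left hs.1]
  have hR (z : ℝ) (hz : R + 1 ≤ z) : f z * (1 - Real.smoothTransition (z - R)) = 0 := by
    rw [Real.smoothTransition.one_of_one_le (by linarith)]; simp
  have hN (z : ℝ) (hz : z ≤ 0) : f z * (1 - Real.smoothTransition (z - R)) = 0 := by
    rw [hf0 z hz, zero_mul]
  refine ⟨fun z => f z * (1 - Real.smoothTransition (z - R)), ?_, ?_, hN, hR, fun z hz => ?_⟩
  · exact hf.mul (contDiff_const.sub (Real.smoothTransition.contDiff.comp (by fun_prop)))
  · refine HasCompactSupport.intro (isCompact_Icc (a := 0) (b := R + 1)) fun z hz => ?_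
    by_cases h : z ≤ 0
    · exact hN z h
    · exact hR z (le_of_lt (by simpa [not_le.1 h |>.le] using hz))
  · simp only
    rw [Real.smoothTransition.zero_of_nonpos (by linarith [hz.2]), hfβ z hz.1]
    simp

/-! ### The characteristic boundary value problem -/

/-- The reciprocals of the diagonal entries of `A c`: a characteristic of the `i`-th equation is a
line `t + slope c i * z = const`. -/
noncomputable def slope (c : ℝ) : Fin 4 → ℝ := ![1, -1, 1 / c, -(1 / c)]

theorem A_mulVec (c : ℝ) (v : Fin 4 → ℝ) (i : Fin 4) :
    (A c *ᵥ v) i = ![1, -1, c, -c] i * v i := by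
  fin_cases i <;> simp [A, Matrix.mulVec, dotProduct, Fin.sum_univ_four]

theorem speed_mul_slope {c : ℝ} (hc : c ≠ 0) (i : Fin 4) : ![1, -1, c, -c] i * slope c i = 1 := by
  fin_cases i <;> simp [slope, hc]

/-- The characteristic boundary value problem, as a system of integral equations: the first, third
and fourth component are integrated from the diagonal `t = z`, and the second component is
integrated from `z = 0`. The fourth component may be integrated from the diagonal also where its
characteristic meets `z = 0` first, because the coefficient is required to vanish for `z ≤ 0`. -/
noncomputable def goursatSystem (c : ℝ) (β : ℝ → ℝ) : CharSystem (Fin 4) where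
  T := LinearMap.toContinuousLinearMap (Matrix.mulVecLin (Matrix.diagonal (-slope c) * B c))
  β := β
  s := slope c
  k := ![1 / 2, 0, c / (1 + c), -(c / (1 - c))]
  r := 0

theorem goursatSystem_T (c : ℝ) (β : ℝ → ℝ) (v : Fin 4 → ℝ) (i : Fin 4) :
    (goursatSystem c β).T v i = -(slope c i * (B c *ᵥ v) i) := by
  simp [goursatSystem, Matrix.mulVec_diagonal]

theorem goursatSystem_start (c : ℝ) (β : ℝ → ℝ) (i : Fin 4) (y : ℝ) :
    (goursatSystem c β).start i y = (goursatSystem c β).k i * y := by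
  simp [CharSystem.start, goursatSystem]

/-- The characteristics of all but the second component start on the diagonal. -/
theorem goursatSystem_k_mul {c : ℝ} (hc0 : 0 < c) (hc1 : c < 1) (β : ℝ → ℝ) {i : Fin 4}
    (hi : i ≠ 1) : (goursatSystem c β).k i * (1 + slope c i) = 1 := by
  have h1 : 1 - c ≠ 0 := by linarith
  have h2 : 1 + c ≠ 0 := by linarith
  fin_cases i
  · norm_num [goursatSystem, slope]
  · exact absurd rfl hi
  · simp [goursatSystem, slope]; field_simp; ring
  · simp [goursatSystem, slope]; field_simp; ring

/-- A weight that decreases towards the diagonal along every line that is not parallel to it. -/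
theorem diagonal_weight_decay {s k m z₀ t₀ z : ℝ} (hm : 0 ≤ m) (hk : k * (1 + s) = 1)
    (h2 : 2 ≤ m * |1 + s|) (hz : z ∈ uIcc (k * (t₀ + s * z₀)) z₀) :
    max z 0 + m * |t₀ + s * z₀ - s * z - z| + |z₀ - z| ≤ max z₀ 0 + m * |t₀ - z₀| := by
  rw [uIcc_comm, ← segment_eq_uIcc, segment_eq_image'] at hz
  obtain ⟨θ, ⟨h0, h1⟩, rfl⟩ := hz
  have e : k * (t₀ + s * z₀) - z₀ = k * (t₀ - z₀) := by linear_combination z₀ * hk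
  simp only [smul_eq_mul]
  rw [e]
  set d := θ * (k * (t₀ - z₀)) with hd
  have e1 : t₀ + s * z₀ - s * (z₀ + d) - (z₀ + d) = (1 - θ) * (t₀ - z₀) := by
    rw [hd]; linear_combination (-(θ * (t₀ - z₀))) * hk
  have e2 : |1 + s| * |d| = θ * |t₀ - z₀| := by
    rw [← abs_mul, show (1 + s) * d = θ * (t₀ - z₀) by
      rw [hd]; linear_combination (θ * (t₀ - z₀)) * hk, abs_mul, abs_of_nonneg h0]
  have e3 : max (z₀ + d) 0 ≤ max z₀ 0 + |d| := by
    refine max_le ?_ (by positivity)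
    linarith [le_abs_self d, le_max_left z₀ 0]
  rw [e1, abs_mul, abs_of_nonneg (sub_nonneg.2 h1), show z₀ - (z₀ + d) = -d by ring, abs_neg]
  nlinarith [mul_le_mul_of_nonneg_right h2 (abs_nonneg d)]

theorem goursatSystem_weight {c b : ℝ} (hc0 : 0 < c) (hc1 : c < 1) {β : ℝ → ℝ}
    (hβ : Continuous β) (hb : ∀ z, |β z| ≤ b) (hβ0 : ∀ z ≤ 0, β z = 0) :
    (goursatSystem c β).IsVolterraWeight b
      (fun x => max x.1 0 + (1 + c) / (1 - c) * |x.2 - x.1|) where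
  continuous_coeff := hβ
  abs_coeff_le := hb
  continuous_weight := by fun_prop
  weight_add_le := by
    intro i x z hz hne
    have hz0 : 0 < z := not_le.1 fun h => hne (hβ0 z h)
    have h1c : 0 < 1 - c := by linarith
    have hm : 1 ≤ (1 + c) / (1 - c) := by rw [le_div_iff₀ h1c]; linarith
    have hσ : 1 < 1 / c := by rw [lt_div_iff₀ hc0]; linarith
    rw [goursatSystem_start] at hz
    by_cases hi : i = 1
    · subst hi
      have hzx : z ≤ x.1 := by
        by_contra hlt
        rw [mem_uIcc] at hz
        simp only [goursatSystem, Matrix.cons_val_one, Matrix.cons_val_zero, zero_mul] at hz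
        rcases hz with h | h
        · exact hlt h.2
        · linarith [h.2]
      have e : (goursatSystem c β).label 1 x - (goursatSystem c β).s 1 * z - z = x.2 - x.1 := by
        simp [CharSystem.label, goursatSystem, slope]
        ring
      simp only
      rw [e, max_eq_left hz0.le, max_eq_left (hz0.le.trans hzx), abs_of_nonneg (sub_nonneg.2 hzx)]
      linarith
    · refine diagonal_weight_decay (by linarith) (goursatSystem_k_mul hc0 hc1 β hi) ?_ hz
      change 2 ≤ _ * |1 + slope c i|
      fin_cases i
      · have : |1 + slope c 0| = 2 := by norm_num [slope]
        simp only [Fin.zero_eta]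
        rw [this]; linarith
      · exact absurd rfl hi
      · have : |1 + slope c 2| = 1 + 1 / c := by simp [slope]; positivity
        simp only [Fin.reduceFinMk]
        rw [this]; nlinarith
      · have : |1 + slope c 3| = (1 - c) / c := by
          simp only [slope, Matrix.cons_val]
          rw [abs_of_neg (by linarith)]; field_simp; ring
        simp only [Fin.reduceFinMk]
        rw [this, div_mul_div_cancel₀ h1c.ne', le_div_iff₀ hc0]
        linarith

theorem exists_goursat_solution {c : ℝ} (hc0 : 0 < c) (hc1 : c < 1) {β : ℝ → ℝ}
    (hβ : ContDiff ℝ 1 β) (hβc : HasCompactSupport β) (hβ0 : ∀ z ≤ 0, β z = 0) (κ : Fin 4 → ℝ) :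
    ∃ u : ℝ × ℝ → Fin 4 → ℝ, ContDiff ℝ 1 u ∧
      (∀ x, fderiv ℝ u x (0, 1) = A c *ᵥ fderiv ℝ u x (1, 0) + β x.1 • (B c *ᵥ u x)) ∧
      (∀ t, 0 ≤ t → u (0, t) 3 = 0) ∧ (∀ t, u (0, t) 1 = κ 1 * β 0) ∧
      ∀ z, ∀ i ≠ 1, u (z, z) i = κ i * β z := by
  obtain ⟨b, hb⟩ := hβ.continuous.bounded_above_of_compact_support hβc
  obtain ⟨b', hb'⟩ := (hβ.continuous_deriv le_rfl).bounded_above_of_compact_support hβc.deriv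
  set S := goursatSystem c β with hS
  let a : ℝ × ℝ → Fin 4 → ℝ := fun x i => κ i * β (S.k i * S.label i x)
  let a' : ℝ × ℝ → Fin 4 → ℝ := fun x i => κ i * (deriv β (S.k i * S.label i x) * S.k i)
  have hlab (i : Fin 4) : ContDiff ℝ 1 (S.label i) := by
    unfold CharSystem.label; fun_prop
  have ha1 : ContDiff ℝ 1 a := contDiff_pi.2 fun i =>
    contDiff_const.mul (hβ.comp (contDiff_const.mul (hlab i)))
  have hdβ (z : ℝ) : HasDerivAt β (deriv β z) z := (hβ.differentiable one_ne_zero z).hasDerivAt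
  have ha : CharSystem.IsBoundedData a a' (max (‖κ‖ * b) (‖κ‖ * (b' * ‖S.k‖))) :=
    { continuous_data := ha1.continuous
      continuous_deriv := by
        have := hβ.continuous_deriv le_rfl
        fun_prop
      hasDerivAt := fun z t i => by
        have h1 : HasDerivAt (fun t' => S.k i * S.label i (z, t')) (S.k i) t :=
          (((hasDerivAt_id t).add_const (S.s i * z)).const_mul (S.k i)).congr_deriv (mul_one _)
        exact ((hdβ _).comp t h1).const_mul (κ i)
      norm_data_le := fun x => by
        refine le_max_of_le_left ?_
        have h0 : 0 ≤ b := (norm_nonneg _).trans (hb 0)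
        rw [pi_norm_le_iff_of_nonneg (by positivity)]
        intro i
        rw [norm_mul]
        exact mul_le_mul (norm_le_pi_norm κ i) (hb _) (norm_nonneg _) (norm_nonneg _)
      norm_deriv_le := fun x => by
        refine le_max_of_le_right ?_
        have h0 : 0 ≤ b' := (norm_nonneg _).trans (hb' 0)
        rw [pi_norm_le_iff_of_nonneg (by positivity)]
        intro i
        rw [norm_mul, norm_mul]
        gcongr
        · exact norm_le_pi_norm κ i
        · exact hb' _
        · exact norm_le_pi_norm S.k i }
  obtain ⟨u, hu, hfix, -, hpde⟩ := CharSystem.exists_contDiff_solution (V := ∅)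
    (goursatSystem_weight hc0 hc1 hβ.continuous hb hβ0) ha ha1
    ⟨by simp, by simp, by simp⟩ (fun x hx => by
      have : 0 < 1 - c := by linarith
      have : 0 ≤ max x.1 0 + (1 + c) / (1 - c) * |x.2 - x.1| := by positivity
      linarith)
  have hfix' (x : ℝ × ℝ) (i : Fin 4) : u x i = κ i * β (S.k i * S.label i x) +
      ∫ z in (S.k i * S.label i x)..x.1, S.src u i z (S.label i x) := by
    rw [hfix x, Pi.add_apply, CharSystem.op, goursatSystem_start]
  have hstart (x : ℝ × ℝ) (i : Fin 4) (h : S.k i * S.label i x = x.1) : u x i = κ i * β x.1 := by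
    rw [hfix', h]; simp
  refine ⟨u, hu, fun x => ?_, fun t ht => ?_, fun t => ?_, fun z i hi => ?_⟩
  · ext i
    have hs := speed_mul_slope hc0.ne' i
    have ha0 : fderiv ℝ a x (1, -S.s i) i = 0 := by
      have h1 := hasFDerivAt_pi'.1 (ha1.differentiable one_ne_zero x).hasFDerivAt i
      have h2 : HasFDerivAt (S.label i) (ContinuousLinearMap.snd ℝ ℝ ℝ +
          S.s i • ContinuousLinearMap.fst ℝ ℝ ℝ) x :=
        (ContinuousLinearMap.snd ℝ ℝ ℝ + S.s i • ContinuousLinearMap.fst ℝ ℝ ℝ).hasFDerivAt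
      have h3 := ((hdβ (S.k i * S.label i x)).comp_hasFDerivAt x
        (h2.const_mul (S.k i))).const_mul (κ i)
      have h4 := congrArg (fun L => L (1, -S.s i)) (h1.unique h3)
      simpa using! h4
    have h := hpde x i
    rw [ha0, zero_add, goursatSystem_T,
      show ((1 : ℝ), -S.s i) = (1, 0) - slope c i • ((0, 1) : ℝ × ℝ) by
        simp [hS, goursatSystem], map_sub, map_smul] at h
    rw [Pi.add_apply, A_mulVec]
    simp only [Pi.sub_apply, Pi.smul_apply, smul_eq_mul] at h ⊢
    have hSβ : S.β x.1 = β x.1 := rfl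
    rw [hSβ] at h
    linear_combination (-![1, -1, c, -c] i) * h +
      (β x.1 * (B c *ᵥ u x) i - fderiv ℝ u x (0, 1) i) * hs
  · have hle : S.k 3 * S.label 3 (0, t) ≤ 0 := by
      have h1 : 0 ≤ c / (1 - c) := div_nonneg hc0.le (by linarith)
      have : S.k 3 * S.label 3 (0, t) = -(c / (1 - c) * t) := by
        simp [hS, goursatSystem, CharSystem.label]
      rw [this]
      linarith [mul_nonneg h1 ht]
    rw [hfix', hβ0 _ hle, intervalIntegral.integral_congr (g := fun _ => 0)]
    · simp
    · intro z hz
      rw [uIcc_of_le hle] at hz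
      have : S.β z = 0 := hβ0 z hz.2
      simp [CharSystem.src, this]
  · exact hstart (0, t) 1 (by simp [hS, goursatSystem])
  · refine hstart (z, z) i ?_
    have := goursatSystem_k_mul hc0 hc1 β hi
    have e : S.label i (z, z) = (1 + slope c i) * z := by
      simp [hS, CharSystem.label, goursatSystem]; ring
    rw [e, ← mul_assoc, this, one_mul]

theorem convex_triangle (Z : ℝ) : Convex ℝ (triangle Z) := by
  have : triangle Z = {x | 0 ≤ x.1} ∩ ({x | x.1 - x.2 ≤ 0} ∩ {x | x.1 + x.2 ≤ 2 * Z}) := by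
    ext x
    simp only [triangle, mem_ofPred_eq, mem_inter_iff]
    constructor <;> rintro ⟨h1, h2, h3⟩ <;> refine ⟨h1, ?_, ?_⟩ <;> linarith
  rw [this]
  refine (convex_halfSpace_ge (LinearMap.isLinear (LinearMap.fst ℝ ℝ ℝ)) 0).inter
    ((convex_halfSpace_le (LinearMap.isLinear (LinearMap.fst ℝ ℝ ℝ - LinearMap.snd ℝ ℝ ℝ)) 0).inter
      (convex_halfSpace_le (LinearMap.isLinear (LinearMap.fst ℝ ℝ ℝ + LinearMap.snd ℝ ℝ ℝ)) _))

theorem isClosed_triangle (Z : ℝ) : IsClosed (triangle Z) :=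
  (isClosed_le continuous_const continuous_fst).inter
    ((isClosed_le continuous_fst continuous_snd).inter
      (isClosed_le continuous_snd (by fun_prop)))

theorem isCompact_triangle (Z : ℝ) : IsCompact (triangle Z) := by
  refine (isCompact_Icc (a := ((0 : ℝ), (0 : ℝ))) (b := (Z, 2 * Z))).of_isClosed_subset
    (isClosed_triangle Z) fun x hx => ?_
  obtain ⟨h1, h2, h3⟩ := hx
  exact ⟨⟨h1, h1.trans h2⟩, ⟨by simp only; linarith, by simp only; linarith⟩⟩

theorem mem_interior_triangle {Z : ℝ} {x : ℝ × ℝ} (h1 : 0 < x.1) (h2 : x.1 < x.2)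
    (h3 : x.2 < 2 * Z - x.1) : x ∈ interior (triangle Z) := by
  refine mem_interior.2 ⟨{x | 0 < x.1 ∧ x.1 < x.2 ∧ x.2 < 2 * Z - x.1}, fun x hx =>
    ⟨hx.1.le, hx.2.1.le, hx.2.2.le⟩, ?_, h1, h2, h3⟩
  exact (isOpen_lt continuous_const continuous_fst).inter
    ((isOpen_lt continuous_fst continuous_snd).inter (isOpen_lt continuous_snd (by fun_prop)))

theorem nonempty_interior_triangle {Z : ℝ} (hZ : 0 < Z) : (interior (triangle Z)).Nonempty :=
  ⟨(Z / 4, Z / 2), mem_interior_triangle (by simp only; linarith) (by simp only; linarith)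
    (by simp only; linarith)⟩

theorem uniqueDiffOn_triangle {Z : ℝ} (hZ : 0 < Z) : UniqueDiffOn ℝ (triangle Z) :=
  uniqueDiffOn_convex (convex_triangle Z) (nonempty_interior_triangle hZ)

theorem exists_isCharacteristicSolution {c Z : ℝ} (hc0 : 0 < c) (hc1 : c < 1) (hZ : 0 < Z)
    {β βe : ℝ → ℝ} (hβe : ContDiff ℝ 1 βe) (h0 : βe 0 = 0) (h1 : deriv βe 0 = 0)
    (he : EqOn βe β (Icc 0 Z)) :
    ∃ m : ℝ × ℝ → Fin 4 → ℝ, IsCharacteristicSolution c Z β m := by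
  obtain ⟨βt, ht1, htc, ht0, -, hte⟩ := exists_truncation hβe h0 h1 Z
  have hβ (z : ℝ) (hz : z ∈ Icc 0 Z) : βt z = β z := (hte hz).trans (he hz)
  obtain ⟨u, hu, hpde, hu3, hu1, hdiag⟩ := exists_goursat_solution hc0 hc1 ht1 htc ht0
    ![0, 0, (c - 1) / (2 * (c + 1)), (c + 1) / (2 * (c - 1))]
  refine ⟨u, hu.contDiffOn, fun x hx => ?_, fun t ht => ⟨?_, hu3 t ht.1⟩, fun z hz => ⟨?_, ?_, ?_⟩⟩
  · rw [fderivWithin_eq_fderiv (uniqueDiffOn_triangle hZ x hx)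
      (hu.differentiable one_ne_zero x), hpde x, hβ x.1 ⟨hx.1, by linarith [hx.2.1, hx.2.2]⟩]
  · simpa using hu1 t
  · simpa using hdiag z 0 (by decide)
  · simpa [hβ z hz] using hdiag z 2 (by decide)
  · simpa [hβ z hz] using hdiag z 3 (by decide)

/-! ### Green's formula on the triangle -/

theorem setIntegral_triangle_eq_dt {Z : ℝ} {g : ℝ × ℝ → ℝ}
    (hg : ContinuousOn g (triangle Z)) (hZ : 0 ≤ Z) :
    ∫ x in triangle Z, g x = ∫ z in (0 : ℝ)..Z, ∫ t in z..(2 * Z - z), g (z, t) := by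
  have hm : MeasurableSet (triangle Z) := (isClosed_triangle Z).measurableSet
  have hi : Integrable ((triangle Z).indicator g) (volume.prod volume) := by
    rw [← Measure.volume_eq_prod, integrable_indicator_iff hm]
    exact hg.integrableOn_compact (isCompact_triangle Z)
  rw [← integral_indicator hm, Measure.volume_eq_prod, integral_prod _ hi,
    intervalIntegral.integral_of_le hZ, ← integral_Icc_eq_integral_Ioc,
    ← integral_indicator measurableSet_Icc]
  congr 1 with z
  by_cases hz : z ∈ Icc 0 Z
  · rw [indicator_of_mem hz, intervalIntegral.integral_of_le (by linarith [hz.2]),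
      ← integral_Icc_eq_integral_Ioc, ← integral_indicator measurableSet_Icc]
    congr 1 with t
    by_cases ht : t ∈ Icc z (2 * Z - z)
    · rw [indicator_of_mem ht, indicator_of_mem (show (z, t) ∈ triangle Z from ⟨hz.1, ht⟩)]
    · rw [indicator_of_notMem ht, indicator_of_notMem fun h : (z, t) ∈ triangle Z => ht h.2]
  · rw [indicator_of_notMem hz]
    refine integral_eq_zero_of_ae (Eventually.of_forall fun t => ?_)
    refine indicator_of_notMem (fun h : (z, t) ∈ triangle Z => hz ⟨h.1, ?_⟩) _
    have h2 := h.2.1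
    have h3 := h.2.2
    simp only at h2 h3
    linarith

theorem setIntegral_triangle_eq_dz {Z : ℝ} {g : ℝ × ℝ → ℝ}
    (hg : ContinuousOn g (triangle Z)) (hZ : 0 ≤ Z) :
    ∫ x in triangle Z, g x =
      ∫ t in (0 : ℝ)..(2 * Z), ∫ z in (0 : ℝ)..(min t (2 * Z - t)), g (z, t) := by
  have hm : MeasurableSet (triangle Z) := (isClosed_triangle Z).measurableSet
  have hi : Integrable ((triangle Z).indicator g) (volume.prod volume) := by
    rw [← Measure.volume_eq_prod, integrable_indicator_iff hm]
    exact hg.integrableOn_compact (isCompact_triangle Z)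
  rw [← integral_indicator hm, Measure.volume_eq_prod, integral_prod_symm _ hi,
    intervalIntegral.integral_of_le (by linarith), ← integral_Icc_eq_integral_Ioc,
    ← integral_indicator measurableSet_Icc]
  congr 1 with t
  by_cases ht : t ∈ Icc 0 (2 * Z)
  · rw [indicator_of_mem ht, intervalIntegral.integral_of_le (le_min ht.1 (by linarith [ht.2])),
      ← integral_Icc_eq_integral_Ioc, ← integral_indicator measurableSet_Icc]
    congr 1 with z
    by_cases hz : z ∈ Icc 0 (min t (2 * Z - t))
    · obtain ⟨h1, h2⟩ := le_min_iff.1 hz.2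
      rw [indicator_of_mem hz,
        indicator_of_mem (show (z, t) ∈ triangle Z from ⟨hz.1, h1, by simp only; linarith⟩)]
    · rw [indicator_of_notMem hz, indicator_of_notMem fun h : (z, t) ∈ triangle Z =>
        hz ⟨h.1, le_min h.2.1 (by have := h.2.2; simp only at this; linarith)⟩]
  · rw [indicator_of_notMem ht]
    refine integral_eq_zero_of_ae (Eventually.of_forall fun z => ?_)
    refine indicator_of_notMem (fun h : (z, t) ∈ triangle Z => ht ?_) _
    obtain ⟨h1, h2, h3⟩ := h
    simp only at h1 h2 h3
    constructor <;> linarith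

section Green

variable {Z : ℝ} {f : ℝ × ℝ → ℝ}

theorem continuousOn_fderivWithin_triangle_apply (hZ : 0 < Z)
    (hf : ContDiffOn ℝ 1 f (triangle Z)) (v : ℝ × ℝ) :
    ContinuousOn (fun x => fderivWithin ℝ f (triangle Z) x v) (triangle Z) :=
  (hf.continuousOn_fderivWithin (uniqueDiffOn_triangle hZ) le_rfl).clm_apply continuousOn_const

theorem hasFDerivAt_of_mem_interior_triangle (hf : ContDiffOn ℝ 1 f (triangle Z)) {x : ℝ × ℝ}
    (hx : x ∈ interior (triangle Z)) : HasFDerivAt f (fderivWithin ℝ f (triangle Z) x) x :=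
  ((hf.differentiableOn one_ne_zero) x (interior_subset hx)).hasFDerivWithinAt.hasFDerivAt
    (mem_interior_iff_mem_nhds.1 hx)

theorem setIntegral_triangle_deriv_t (hZ : 0 < Z) (hf : ContDiffOn ℝ 1 f (triangle Z))
    (h0 : ∀ x ∈ triangle Z, x.1 + x.2 = 2 * Z → f x = 0) :
    ∫ x in triangle Z, fderivWithin ℝ f (triangle Z) x (0, 1) = -∫ z in (0 : ℝ)..Z, f (z, z) := by
  have hc := continuousOn_fderivWithin_triangle_apply hZ hf (0, 1)
  rw [setIntegral_triangle_eq_dt hc hZ.le, ← intervalIntegral.integral_neg]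
  refine intervalIntegral.integral_congr_ae ?_
  have hne : ∀ᵐ z : ℝ, z ≠ Z := by simp [ae_iff]
  filter_upwards [hne] with z hzZ hz
  rw [uIoc_of_le hZ.le] at hz
  have hzZ' : z < Z := lt_of_le_of_ne hz.2 hzZ
  have hmaps : MapsTo (fun t : ℝ => (z, t)) (Icc z (2 * Z - z)) (triangle Z) := fun t ht =>
    ⟨hz.1.le, ht⟩
  have hle : z ≤ 2 * Z - z := by linarith
  rw [intervalIntegral.integral_eq_sub_of_hasDerivAt_of_le (f := fun t => f (z, t)) hle
    (hf.continuousOn.comp (by fun_prop) hmaps), h0 (z, 2 * Z - z) ⟨hz.1.le, hle, le_rfl⟩ (by simp),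
    zero_sub]
  · intro t ht
    have h1 := hasFDerivAt_of_mem_interior_triangle hf (x := (z, t))
      (mem_interior_triangle hz.1 ht.1 ht.2)
    exact h1.comp_hasDerivAt t ((hasDerivAt_const t z).prodMk (hasDerivAt_id t))
  · refine ContinuousOn.intervalIntegrable ?_
    rw [uIcc_of_le hle]
    exact hc.comp (by fun_prop) hmaps

theorem setIntegral_triangle_deriv_z (hZ : 0 < Z) (hf : ContDiffOn ℝ 1 f (triangle Z))
    (h0 : ∀ x ∈ triangle Z, x.1 + x.2 = 2 * Z → f x = 0) :
    ∫ x in triangle Z, fderivWithin ℝ f (triangle Z) x (1, 0) =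
      (∫ z in (0 : ℝ)..Z, f (z, z)) - ∫ t in (0 : ℝ)..(2 * Z), f (0, t) := by
  have hc := continuousOn_fderivWithin_triangle_apply hZ hf (1, 0)
  have hmem (t : ℝ) (ht : t ∈ Icc 0 (2 * Z)) (z : ℝ) (hz : z ∈ Icc 0 (min t (2 * Z - t))) :
      (z, t) ∈ triangle Z := by
    obtain ⟨h1, h2⟩ := le_min_iff.1 hz.2
    exact ⟨hz.1, h1, by simp only; linarith⟩
  have hmin (t : ℝ) (ht : t ∈ Icc 0 (2 * Z)) : 0 ≤ min t (2 * Z - t) :=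
    le_min ht.1 (by linarith [ht.2])
  have e : ∫ x in triangle Z, fderivWithin ℝ f (triangle Z) x (1, 0) =
      ∫ t in (0 : ℝ)..(2 * Z), (f (min t (2 * Z - t), t) - f (0, t)) := by
    rw [setIntegral_triangle_eq_dz hc hZ.le]
    refine intervalIntegral.integral_congr fun t ht => ?_
    rw [uIcc_of_le (by linarith)] at ht
    have hmaps : MapsTo (fun z : ℝ => (z, t)) (Icc 0 (min t (2 * Z - t))) (triangle Z) :=
      hmem t ht
    refine intervalIntegral.integral_eq_sub_of_hasDerivAt_of_le (f := fun z => f (z, t))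
      (hmin t ht) (hf.continuousOn.comp (by fun_prop) hmaps) ?_ ?_
    · intro z hz
      obtain ⟨h1, h2⟩ := lt_min_iff.1 hz.2
      have h1 := hasFDerivAt_of_mem_interior_triangle hf (x := (z, t))
        (mem_interior_triangle hz.1 h1 (by simp only; linarith))
      exact h1.comp_hasDerivAt z ((hasDerivAt_id z).prodMk (hasDerivAt_const z t))
    · refine ContinuousOn.intervalIntegrable ?_
      rw [uIcc_of_le (hmin t ht)]
      exact hc.comp (by fun_prop) hmaps
  have c1 : ContinuousOn (fun t => f (min t (2 * Z - t), t)) (Icc 0 (2 * Z)) :=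
    hf.continuousOn.comp (by fun_prop) fun t ht => hmem t ht _ ⟨hmin t ht, le_rfl⟩
  have c2 : ContinuousOn (fun t => f (0, t)) (Icc 0 (2 * Z)) :=
    hf.continuousOn.comp (by fun_prop) fun t ht => hmem t ht _ ⟨le_rfl, hmin t ht⟩
  rw [e, intervalIntegral.integral_sub, ← intervalIntegral.integral_add_adjacent_intervals (b := Z),
    intervalIntegral.integral_congr (a := 0) (b := Z) (g := fun t => f (t, t)),
    intervalIntegral.integral_congr (a := Z) (b := 2 * Z) (g := fun _ => 0)]
  · simp
  · intro t ht
    rw [uIcc_of_le (by linarith)] at ht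
    have ht' : t ∈ Icc 0 (2 * Z) := ⟨hZ.le.trans ht.1, ht.2⟩
    refine h0 _ (hmem t ht' _ ⟨hmin t ht', le_rfl⟩) ?_
    rw [min_eq_right (by linarith [ht.1])]
    ring
  · intro t ht
    rw [uIcc_of_le hZ.le] at ht
    simp only
    rw [min_eq_left (by linarith [ht.2])]
  · refine (c1.mono ?_).intervalIntegrable
    rw [uIcc_of_le hZ.le]
    exact Icc_subset_Icc_right (by linarith)
  · refine (c1.mono ?_).intervalIntegrable
    rw [uIcc_of_le (by linarith)]
    exact Icc_subset_Icc_left hZ.le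
  · refine ContinuousOn.intervalIntegrable ?_
    rwa [uIcc_of_le (by linarith)]
  · refine ContinuousOn.intervalIntegrable ?_
    rwa [uIcc_of_le (by linarith)]

end Green

/-! ### The progressing wave is an impulsive solution -/

theorem dt_apply {Z : ℝ} (φ : 𝓓^{2}(halfPlane Z, ℝ)) (x : ℝ × ℝ) :
    dt φ x = fderiv ℝ φ x (0, 1) := by
  rw [dt, TestFunction.lineDerivCLM_apply_of_le (by norm_num)]
  exact ((φ.contDiff.differentiable (by norm_num)) x).lineDeriv_eq_fderiv

theorem dz_apply {Z : ℝ} (φ : 𝓓^{2}(halfPlane Z, ℝ)) (x : ℝ × ℝ) :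
    dz φ x = fderiv ℝ φ x (1, 0) := by
  rw [dz, TestFunction.lineDerivCLM_apply_of_le (by norm_num)]
  exact ((φ.contDiff.differentiable (by norm_num)) x).lineDeriv_eq_fderiv

theorem mulTest_apply {Z : ℝ} (β : ℝ → ℝ) (hβ : ContDiff ℝ 1 β) (φ : 𝓓^{2}(halfPlane Z, ℝ))
    (x : ℝ × ℝ) : mulTest β hβ φ x = β x.1 * φ x := rfl

theorem traceTest_apply {Z : ℝ} (φ : 𝓓^{2}(halfPlane Z, ℝ)) (t : ℝ) :
    traceTest φ t = φ (0, t) := rfl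

/-- Integration along the segment `z = t`, `0 ≤ z ≤ Z`. -/
noncomputable def diagonalIntegral (Z : ℝ) : 𝓓^{1}(halfPlane Z, ℝ) →L[ℝ] ℝ :=
  TestFunction.mkCLM ℝ (fun φ => ∫ z in (0 : ℝ)..Z, φ (z, z))
    (fun f g => intervalIntegral.integral_add
      (Continuous.intervalIntegrable (f.continuous.comp (by fun_prop)) _ _)
      (Continuous.intervalIntegrable (g.continuous.comp (by fun_prop)) _ _))
    (fun c f => intervalIntegral.integral_const_mul c _)
    (fun K hK => by
      refine intervalIntegral.continuous_parametric_intervalIntegral_of_continuous'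
        (f := fun (φ : 𝓓^{1}_{K}(ℝ × ℝ, ℝ)) z => φ (z, z)) ?_ 0 Z
      have : Continuous fun p : 𝓓^{1}_{K}(ℝ × ℝ, ℝ) × ℝ => p.1 ((p.2, p.2) : ℝ × ℝ) := by fun_prop
      exact this)

theorem locallyIntegrableOn_restrict {X F : Type*} [TopologicalSpace X] [MeasurableSpace X]
    [OpensMeasurableSpace X] [NormedAddCommGroup F] {μ : Measure X} {K : Set X} {f : X → F}
    {s : Set X} (h : IntegrableOn f K μ) : LocallyIntegrableOn f s (μ.restrict K) :=
  (show Integrable f (μ.restrict K) from h).locallyIntegrable.locallyIntegrableOn s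

theorem exists_hasProgressingForm {Z : ℝ} {m : ℝ × ℝ → Fin 4 → ℝ}
    (hm : ContinuousOn m (triangle Z)) :
    ∃ M : 𝓓'^{1}(halfPlane Z, Fin 4 → ℝ), HasProgressingForm Z m M := by
  have hl : LocallyIntegrableOn m (halfPlane Z) (volume.restrict (triangle Z)) :=
    locallyIntegrableOn_restrict (hm.integrableOn_compact (isCompact_triangle Z))
  let L : 𝓓^{1}(halfPlane Z, ℝ) →L[ℝ] (Fin 4 → ℝ) :=
    (diagonalIntegral Z).smulRight ![0, 1, 0, 0] +
      TestFunction.integralAgainstBilinCLM (ContinuousLinearMap.lsmul ℝ ℝ)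
        (volume.restrict (triangle Z)) m
  refine ⟨L, fun φ => ?_⟩
  change (∫ z in (0 : ℝ)..Z, φ (z, z)) • ![0, 1, 0, 0] + TestFunction.integralAgainstBilinCLM
    (ContinuousLinearMap.lsmul ℝ ℝ) (volume.restrict (triangle Z)) m φ = _
  rw [TestFunction.integralAgainstBilinCLM_eq_integral hl]
  rfl

/-- The boundary values of the progressing wave. -/
theorem exists_boundary_distribution {Z : ℝ} {g : ℝ → Fin 4 → ℝ}
    (hg : ContinuousOn g (Icc 0 (2 * Z))) :
    ∃ b : 𝓓'^{2}(timeLine Z, Fin 4 → ℝ), ∀ χ : 𝓓^{2}(timeLine Z, ℝ),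
      b χ = χ 0 • ![0, 1, 0, 0] + ∫ t in Icc 0 (2 * Z), χ t • g t := by
  have hl : LocallyIntegrableOn g (timeLine Z) (volume.restrict (Icc 0 (2 * Z))) :=
    locallyIntegrableOn_restrict (hg.integrableOn_compact isCompact_Icc)
  let δ : 𝓓^{2}(timeLine Z, ℝ) →L[ℝ] ℝ :=
    { toFun := fun χ => χ 0
      map_add' := fun _ _ => rfl
      map_smul' := fun _ _ => rfl
      cont := continuous_eval_const (0 : ℝ) }
  let L : 𝓓^{2}(timeLine Z, ℝ) →L[ℝ] (Fin 4 → ℝ) :=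
    δ.smulRight ![0, 1, 0, 0] +
      TestFunction.integralAgainstBilinCLM (ContinuousLinearMap.lsmul ℝ ℝ)
        (volume.restrict (Icc 0 (2 * Z))) g
  refine ⟨L, fun χ => ?_⟩
  change χ 0 • ![0, 1, 0, 0] + TestFunction.integralAgainstBilinCLM
    (ContinuousLinearMap.lsmul ℝ ℝ) (volume.restrict (Icc 0 (2 * Z))) g χ = _
  rw [TestFunction.integralAgainstBilinCLM_eq_integral hl]
  rfl

theorem HasProgressingForm.apply {Z : ℝ} {m : ℝ × ℝ → Fin 4 → ℝ}
    {M : 𝓓'^{1}(halfPlane Z, Fin 4 → ℝ)} (hM : HasProgressingForm Z m M)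
    (hm : ContinuousOn m (triangle Z)) (φ : 𝓓^{1}(halfPlane Z, ℝ)) (i : Fin 4) :
    M φ i = (∫ z in (0 : ℝ)..Z, φ (z, z)) * ![0, 1, 0, 0] i + ∫ x in triangle Z, φ x * m x i := by
  rw [hM φ, Pi.add_apply, eval_integral]
  · rfl
  · intro j
    exact ((φ.continuous.continuousOn.smul (continuousOn_pi.1 hm j)).integrableOn_compact
      (isCompact_triangle Z))

section Equation

variable {c Z : ℝ} {β : ℝ → ℝ} {m : ℝ × ℝ → Fin 4 → ℝ}

/-- Green's formula for one component of a characteristic solution. -/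
theorem IsCharacteristicSolution.green (hm : IsCharacteristicSolution c Z β m) (hZ : 0 < Z)
    (hβ : ContinuousOn β (Icc 0 Z)) (φ : 𝓓^{2}(halfPlane Z, ℝ)) (i : Fin 4) :
    -(∫ x in triangle Z, fderiv ℝ φ x (0, 1) * m x i) +
        ![1, -1, c, -c] i * (∫ x in triangle Z, fderiv ℝ φ x (1, 0) * m x i) -
        ∫ x in triangle Z, β x.1 * φ x * (B c *ᵥ m x) i =
      (1 + ![1, -1, c, -c] i) * (∫ z in (0 : ℝ)..Z, φ (z, z) * m (z, z) i) -
        ![1, -1, c, -c] i * ∫ t in (0 : ℝ)..(2 * Z), φ (0, t) * m (0, t) i := by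
  set T := triangle Z
  set a := ![1, -1, c, -c] i
  have hT : IsCompact T := isCompact_triangle Z
  have hTm : MeasurableSet T := (isClosed_triangle Z).measurableSet
  have hu := uniqueDiffOn_triangle hZ
  have hmi : ContDiffOn ℝ 1 (fun x => m x i) T := contDiffOn_pi.1 hm.contDiffOn i
  have hφ1 : ContDiff ℝ 1 φ := φ.contDiff.of_le (by norm_num)
  have hf : ContDiffOn ℝ 1 (fun x => φ x * m x i) T := hφ1.contDiffOn.mul hmi
  have h0 : ∀ x ∈ T, x.1 + x.2 = 2 * Z → φ x * m x i = 0 := fun x _ hx => by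
    have hφx : φ x = 0 := image_eq_zero_of_notMem_tsupport fun h =>
      (show x.1 + x.2 < 2 * Z from φ.tsupport_subset h).ne hx
    rw [hφx, zero_mul]
  have hmd (x : ℝ × ℝ) (hx : x ∈ T) (v : ℝ × ℝ) :
      fderivWithin ℝ (fun x => m x i) T x v = fderivWithin ℝ m T x v i := by
    have := hasFDerivWithinAt_pi'.1
      (hm.contDiffOn.differentiableOn one_ne_zero x hx).hasFDerivWithinAt i
    rw [this.fderivWithin (hu x hx)]
    rfl
  have hfd (x : ℝ × ℝ) (hx : x ∈ T) (v : ℝ × ℝ) :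
      fderivWithin ℝ (fun x => φ x * m x i) T x v =
        φ x * fderivWithin ℝ m T x v i + fderiv ℝ φ x v * m x i := by
    have h1 := (hφ1.differentiable one_ne_zero x).hasFDerivAt.hasFDerivWithinAt (s := T)
    have h2 := (hmi.differentiableOn one_ne_zero x hx).hasFDerivWithinAt
    have h3 : HasFDerivWithinAt (fun x => φ x * m x i) _ T x := h1.mul h2
    rw [h3.fderivWithin (hu x hx), ← hmd x hx v]
    simp [mul_comm]
  have cφ : ContinuousOn φ T := φ.continuous.continuousOn
  have cmd (v : ℝ × ℝ) : ContinuousOn (fun x => fderivWithin ℝ m T x v i) T :=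
    (continuousOn_fderivWithin_triangle_apply hZ hmi v).congr fun x hx => (hmd x hx v).symm
  have cφd (v : ℝ × ℝ) : ContinuousOn (fun x => fderiv ℝ φ x v) T :=
    ((hφ1.continuous_fderiv one_ne_zero).clm_apply continuous_const).continuousOn
  have cm : ContinuousOn (fun x => m x i) T := hmi.continuousOn
  have cβ : ContinuousOn (fun x : ℝ × ℝ => β x.1) T :=
    hβ.comp continuousOn_fst fun x hx => ⟨hx.1, by linarith [hx.2.1, hx.2.2]⟩
  have cB : ContinuousOn (fun x => (B c *ᵥ m x) i) T :=
    ((continuous_apply i).comp (LinearMap.continuous_of_finiteDimensional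
      (Matrix.mulVecLin (B c)))).comp_continuousOn hm.contDiffOn.continuousOn
  have split (v : ℝ × ℝ) : ∫ x in T, fderivWithin ℝ (fun x => φ x * m x i) T x v =
      (∫ x in T, φ x * fderivWithin ℝ m T x v i) + ∫ x in T, fderiv ℝ φ x v * m x i := by
    have i1 : IntegrableOn (fun x => φ x * fderivWithin ℝ m T x v i) T :=
      (cφ.mul (cmd v)).integrableOn_compact hT
    have i2 : IntegrableOn (fun x => fderiv ℝ φ x v * m x i) T :=
      ((cφd v).mul cm).integrableOn_compact hT
    rw [← integral_add i1 i2]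
    exact setIntegral_congr_fun hTm fun x hx => hfd x hx v
  have pde : ∫ x in T, φ x * fderivWithin ℝ m T x (0, 1) i =
      a * (∫ x in T, φ x * fderivWithin ℝ m T x (1, 0) i) +
        ∫ x in T, β x.1 * φ x * (B c *ᵥ m x) i := by
    have i1 : IntegrableOn (fun x => a * (φ x * fderivWithin ℝ m T x (1, 0) i)) T :=
      ((cφ.mul (cmd (1, 0))).const_mul a).integrableOn_compact hT
    have i2 : IntegrableOn (fun x => β x.1 * φ x * (B c *ᵥ m x) i) T :=
      ((cβ.mul cφ).mul cB).integrableOn_compact hT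
    rw [← integral_const_mul, ← integral_add i1 i2]
    refine setIntegral_congr_fun hTm fun x hx => ?_
    rw [hm.pde x hx, Pi.add_apply, A_mulVec, Pi.smul_apply, smul_eq_mul]
    ring
  have g1 := setIntegral_triangle_deriv_t hZ hf h0
  have g2 := setIntegral_triangle_deriv_z hZ hf h0
  rw [split] at g1 g2
  linear_combination (-1) * g1 + a * g2 + pde

/-- On the diagonal the data of the characteristic problem balance the source that the delta
function produces through `β B`. -/
theorem IsCharacteristicSolution.diagonal_balance (hm : IsCharacteristicSolution c Z β m)
    (hc0 : 0 < c) (hc1 : c < 1) {z : ℝ} (hz : z ∈ Icc 0 Z) (i : Fin 4) :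
    (1 + ![1, -1, c, -c] i) * m (z, z) i = β z * B c i 1 := by
  obtain ⟨h0, h2, h3⟩ := hm.diagonal z hz
  have h1 : c - 1 ≠ 0 := by linarith
  have h4 : c + 1 ≠ 0 := by linarith
  fin_cases i
  · simp [h0, B]
  · simp [B]
  · simp [h2, B]; field_simp; ring
  · simp [h3, B]; field_simp; ring

theorem integral_diagonal_deriv (φ : 𝓓^{2}(halfPlane Z, ℝ)) :
    (∫ z in (0 : ℝ)..Z, fderiv ℝ φ (z, z) (0, 1)) + ∫ z in (0 : ℝ)..Z, fderiv ℝ φ (z, z) (1, 0) =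
      -φ (0, 0) := by
  have hφ1 : ContDiff ℝ 1 φ := φ.contDiff.of_le (by norm_num)
  have cφd (v : ℝ × ℝ) : Continuous fun z : ℝ => fderiv ℝ φ (z, z) v :=
    ((hφ1.continuous_fderiv one_ne_zero).comp (by fun_prop)).clm_apply continuous_const
  have hd (z : ℝ) : HasDerivAt (fun z : ℝ => φ (z, z))
      (fderiv ℝ φ (z, z) (0, 1) + fderiv ℝ φ (z, z) (1, 0)) z := by
    have h1 := (hφ1.differentiable one_ne_zero (z, z)).hasFDerivAt
    have h2 := HasFDerivAt.comp_hasDerivAt (f := fun z : ℝ => (z, z)) z h1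
      ((hasDerivAt_id z).prodMk (hasDerivAt_id z))
    refine h2.congr_deriv ?_
    rw [← map_add]
    simp
  have e : φ (Z, Z) = 0 := image_eq_zero_of_notMem_tsupport fun h =>
    (show Z + Z < 2 * Z from φ.tsupport_subset h).ne (by ring)
  rw [← intervalIntegral.integral_add ((cφd _).intervalIntegrable _ _)
    ((cφd _).intervalIntegrable _ _),
    intervalIntegral.integral_eq_sub_of_hasDerivAt (fun z _ => hd z)
      (((cφd _).add (cφd _)).intervalIntegrable _ _), e, zero_sub]

theorem IsCharacteristicSolution.isImpulsiveSolution (hm : IsCharacteristicSolution c Z β m)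
    (hc0 : 0 < c) (hc1 : c < 1) (hZ : 0 < Z) {βe : ℝ → ℝ} (hβe : ContDiff ℝ 1 βe)
    (he : EqOn βe β (Icc 0 Z)) {M : 𝓓'^{1}(halfPlane Z, Fin 4 → ℝ)}
    (hM : HasProgressingForm Z m M) : IsImpulsiveSolution c Z βe hβe M := by
  have cm := hm.contDiffOn.continuousOn
  have hβ : ContinuousOn β (Icc 0 Z) := hβe.continuous.continuousOn.congr he.symm
  have vanish (φ : 𝓓^{1}(halfPlane Z, ℝ)) (h : ∀ x ∈ triangle Z, φ x = 0) : M φ = 0 := by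
    rw [hM φ, intervalIntegral.integral_congr (g := fun _ => 0),
      setIntegral_congr_fun (isClosed_triangle Z).measurableSet (g := fun _ => 0)]
    · simp
    · intro x hx
      simp [h x hx]
    · intro z hz
      rw [uIcc_of_le hZ.le] at hz
      exact h (z, z) ⟨hz.1, le_rfl, by simp only; linarith [hz.2]⟩
  have hg : ContinuousOn (fun t : ℝ => m (0, t)) (Icc 0 (2 * Z)) :=
    cm.comp (by fun_prop) fun t ht => ⟨le_rfl, ht.1, by simpa using ht.2⟩
  have hpt {x : ℝ × ℝ} (hx : x ∈ triangle Z) : x.1 ∈ Icc 0 Z :=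
    ⟨hx.1, by linarith [hx.2.1, hx.2.2]⟩
  obtain ⟨b, hb⟩ := exists_boundary_distribution hg
  have hbi (χ : 𝓓^{2}(timeLine Z, ℝ)) (i : Fin 4) : b χ i = χ 0 * ![0, 1, 0, 0] i +
      ∫ t in (0 : ℝ)..(2 * Z), χ t * m (0, t) i := by
    rw [hb χ, Pi.add_apply, eval_integral, intervalIntegral.integral_of_le (by linarith),
      ← integral_Icc_eq_integral_Ioc]
    · rfl
    · intro j
      exact ((χ.continuous.continuousOn.smul (continuousOn_pi.1 hg j)).integrableOn_compact
        isCompact_Icc)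
  refine ⟨fun φ hφ => vanish φ fun x hx => ?_, fun φ hφ => vanish φ fun x hx => ?_, b,
    fun φ => ?_, fun χ => ?_, fun χ => ?_⟩
  · exact image_eq_zero_of_notMem_tsupport fun h => not_lt.2 hx.1 (hφ h)
  · exact image_eq_zero_of_notMem_tsupport fun h => not_lt.2 (hx.1.trans hx.2.1) (hφ h)
  · ext i
    have hBM : (B c *ᵥ M (mulTest βe hβe φ)) i =
        (∫ z in (0 : ℝ)..Z, β z * φ (z, z)) * B c i 1 +
          ∫ x in triangle Z, β x.1 * φ x * (B c *ᵥ m x) i := by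
      have e1 : ∫ z in (0 : ℝ)..Z, mulTest βe hβe φ (z, z) = ∫ z in (0 : ℝ)..Z, β z * φ (z, z) := by
        refine intervalIntegral.integral_congr fun z hz => ?_
        rw [uIcc_of_le hZ.le] at hz
        simp only [mulTest_apply, he hz]
      have e2 (j : Fin 4) : ∫ x in triangle Z, mulTest βe hβe φ x * m x j =
          ∫ x in triangle Z, β x.1 * φ x * m x j :=
        setIntegral_congr_fun (isClosed_triangle Z).measurableSet fun x hx => by
          simp only [mulTest_apply, he (hpt hx)]
      have e3 : ∫ x in triangle Z, β x.1 * φ x * (B c *ᵥ m x) i =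
          ∑ j, B c i j * ∫ x in triangle Z, β x.1 * φ x * m x j := by
        simp only [Matrix.mulVec, dotProduct, Finset.mul_sum, ← integral_const_mul]
        rw [integral_finsetSum]
        · refine Finset.sum_congr rfl fun j _ =>
            integral_congr_ae (Eventually.of_forall fun x => ?_)
          simp only
          ring
        · intro j _
          refine ContinuousOn.integrableOn_compact (isCompact_triangle Z) ?_
          have c1 : ContinuousOn (fun x : ℝ × ℝ => β x.1) (triangle Z) :=
            hβ.comp continuousOn_fst fun x hx => hpt hx
          exact (c1.mul φ.continuous.continuousOn).mul
            (continuousOn_const.mul (continuousOn_pi.1 cm j))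
      rw [e3, Matrix.mulVec, dotProduct]
      simp only [hM.apply cm, e1, e2, mul_add, Finset.sum_add_distrib]
      congr 1
      simp [Fin.sum_univ_four, mul_comm]
    have hdiag : (1 + ![1, -1, c, -c] i) * (∫ z in (0 : ℝ)..Z, φ (z, z) * m (z, z) i) =
        (∫ z in (0 : ℝ)..Z, β z * φ (z, z)) * B c i 1 := by
      rw [← intervalIntegral.integral_const_mul, ← intervalIntegral.integral_mul_const]
      refine intervalIntegral.integral_congr fun z hz => ?_
      rw [uIcc_of_le hZ.le] at hz
      linear_combination φ (z, z) * hm.diagonal_balance hc0 hc1 hz i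
    have hgreen := hm.green hZ hβ φ i
    have hδ : ![1, -1, c, -c] i * ![0, 1, 0, 0] i = -![(0 : ℝ), 1, 0, 0] i := by
      fin_cases i <;> simp
    simp only [Pi.sub_apply, Pi.add_apply, Pi.neg_apply, A_mulVec, hBM, hbi, hM.apply cm,
      dt_apply, dz_apply, traceTest_apply]
    linear_combination hgreen + hdiag - ![(0 : ℝ), 1, 0, 0] i * integral_diagonal_deriv φ +
      ((∫ z in (0 : ℝ)..Z, fderiv ℝ φ (z, z) (1, 0)) + φ (0, 0)) * hδ
  · have : ∫ t in (0 : ℝ)..(2 * Z), χ t * m (0, t) 1 = 0 := by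
      rw [intervalIntegral.integral_congr (g := fun _ => 0)]
      · simp
      · intro t ht
        rw [uIcc_of_le (by linarith)] at ht
        simp [(hm.left t ht).1]
    rw [hbi, this]
    simp
  · have : ∫ t in (0 : ℝ)..(2 * Z), χ t * m (0, t) 3 = 0 := by
      rw [intervalIntegral.integral_congr (g := fun _ => 0)]
      · simp
      · intro t ht
        rw [uIcc_of_le (by linarith)] at ht
        simp [(hm.left t ht).2]
    rw [hbi, this]
    simp

end Equation

/-- The regular part of a progressing wave is determined by the distribution. -/
theorem HasProgressingForm.eqOn {Z : ℝ} (hZ : 0 < Z) {m m' : ℝ × ℝ → Fin 4 → ℝ}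
    (hm : ContinuousOn m (triangle Z)) (hm' : ContinuousOn m' (triangle Z))
    {M : 𝓓'^{1}(halfPlane Z, Fin 4 → ℝ)} (hM : HasProgressingForm Z m M)
    (hM' : HasProgressingForm Z m' M) : EqOn m' m (triangle Z) := by
  set U := interior (triangle Z)
  have hUT : U ⊆ triangle Z := interior_subset
  have hd : ContinuousOn (m' - m) (triangle Z) := hm'.sub hm
  have hcl : triangle Z ⊆ closure U := by
    rw [(convex_triangle Z).closure_interior_eq_closure_of_nonempty_interior
      (nonempty_interior_triangle hZ)]
    exact subset_closure
  have hUH : U ⊆ halfPlane Z := by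
    intro x hx
    -- A point of the interior can be moved in the direction of the `t`-axis.
    obtain ⟨ε, hε, hb⟩ := Metric.isOpen_iff.1 isOpen_interior x hx
    have : ((x.1, x.2 + ε / 2) : ℝ × ℝ) ∈ triangle Z := hUT (hb (by
      rw [Metric.mem_ball, Prod.dist_eq]
      simp [abs_of_pos hε, hε]))
    have h3 := this.2.2
    simp only at h3
    change x.1 + x.2 < 2 * Z
    linarith
  have hint (f : ℝ × ℝ → Fin 4 → ℝ) (hf : ContinuousOn f (triangle Z)) (g : ℝ × ℝ → ℝ)
      (hg : Continuous g) : IntegrableOn (fun x => g x • f x) (triangle Z) :=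
    (hg.continuousOn.smul hf).integrableOn_compact (isCompact_triangle Z)
  have hae : ∀ᵐ x, x ∈ U → (m' - m) x = 0 := by
    refine isOpen_interior.ae_eq_zero_of_integral_contDiff_smul_eq_zero
      (hd.mono hUT |>.locallyIntegrableOn isOpen_interior.measurableSet) fun g hg hgc hgs => ?_
    let φ : 𝓓^{1}(halfPlane Z, ℝ) :=
      ⟨g, hg.of_le (by exact_mod_cast le_top), hgc, hgs.trans hUH⟩
    have e : ∫ x in triangle Z, g x • m x = ∫ x in triangle Z, g x • m' x :=
      add_left_cancel ((hM φ).symm.trans (hM' φ))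
    have e2 : ∫ x, g x • (m' - m) x = ∫ x in triangle Z, g x • (m' - m) x := by
      refine (setIntegral_eq_integral_of_forall_compl_eq_zero fun x hx => ?_).symm
      rw [image_eq_zero_of_notMem_tsupport fun h => hx (hUT (hgs h)), zero_smul]
    rw [e2]
    simp only [Pi.sub_apply, smul_sub]
    rw [integral_sub (hint m' hm' g hg.continuous) (hint m hm g hg.continuous), e, sub_self]
  have hU : EqOn m' m U := by
    refine Measure.eqOn_open_of_ae_eq (μ := volume) ?_ isOpen_interior (hm'.mono hUT) (hm.mono hUT)
    rw [EventuallyEq, ae_restrict_iff' isOpen_interior.measurableSet]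
    filter_upwards [hae] with x hx hxU
    exact sub_eq_zero.1 (hx hxU)
  exact hU.of_subset_closure hm' hm hUT hcl

/-! ### Approximation of test functions by shifts and time averages -/

theorem exists_modulus_of_continuity {E G : Type*} [NormedAddCommGroup E] [NormedAddCommGroup G]
    {f : E → G}
    (hf : Continuous f) (hc : HasCompactSupport f) {ε : ℝ} (hε : 0 < ε) :
    ∃ δ > 0, ∀ x h : E, ‖h‖ < δ → ‖f (x + h) - f x‖ ≤ ε := by
  obtain ⟨δ, hδ, H⟩ := Metric.uniformContinuous_iff.1 (hc.uniformContinuous_of_continuous hf) ε hε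
  refine ⟨δ, hδ, fun x h hh => ?_⟩
  have := H (a := x + h) (b := x) (by simpa [dist_eq_norm] using hh)
  rw [dist_eq_norm] at this
  exact this.le

section Convergence

variable {E F : Type*} [NormedAddCommGroup E] [NormedSpace ℝ E] [NormedAddCommGroup F]
  [NormedSpace ℝ F] {Ω : Opens E}

/-- A function with a given compact support as a test function. -/
noncomputable def testOfCompact {n : ℕ∞} (f : E → ℝ) (hf : ContDiff ℝ n f) (K : Compacts E)
    (hK : (K : Set E) ⊆ Ω) (h : ∀ x, f x ≠ 0 → x ∈ K) : 𝓓^{n}(Ω, ℝ) :=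
  TestFunction.ofSupportedIn hK (ContDiffMapSupportedIn.of_support_subset hf h)

/-- A distribution of order at most one is sequentially continuous for uniform convergence of test
functions and of their first derivatives, if the supports lie in a common compact set. -/
theorem tendsto_distribution_apply (M : 𝓓'^{1}(Ω, F)) (K : Compacts E) (hK : (K : Set E) ⊆ Ω)
    {f : ℕ → 𝓓^{1}(Ω, ℝ)} {g : 𝓓^{1}(Ω, ℝ)} (hf : ∀ n x, f n x ≠ 0 → x ∈ K)
    (hg : ∀ x, g x ≠ 0 → x ∈ K)
    (h : ∀ ε > 0, ∀ᶠ n in atTop, ∀ x, |f n x - g x| ≤ ε ∧ ‖fderiv ℝ (f n) x - fderiv ℝ g x‖ ≤ ε) :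
    Tendsto (fun n => M (f n)) atTop (𝓝 (M g)) := by
  let fK (n : ℕ) : 𝓓^{1}_{K}(E, ℝ) := .of_support_subset (f n).contDiff (hf n)
  let gK : 𝓓^{1}_{K}(E, ℝ) := .of_support_subset g.contDiff hg
  have hM : Continuous fun φ : 𝓓^{1}(Ω, ℝ) => M φ := ContinuousLinearMap.continuous _
  have hc : Continuous fun φ : 𝓓^{1}_{K}(E, ℝ) => M (TestFunction.ofSupportedIn hK φ) :=
    hM.comp (TestFunction.continuous_ofSupportedIn hK)
  have hlim : Tendsto fK atTop (𝓝 gK) := by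
    rw [(ContDiffMapSupportedIn.withSeminorms ℝ E ℝ 1 K).tendsto_nhds]
    intro i ε hε
    filter_upwards [h (ε / 2) (half_pos hε)] with n hn
    refine lt_of_le_of_lt ?_ (half_lt_self hε)
    rw [ContDiffMapSupportedIn.seminorm_le_iff ℝ (half_pos hε).le]
    intro hi x _
    have df := (f n).contDiff.differentiable one_ne_zero x
    have dg := g.contDiff.differentiable one_ne_zero x
    have hi' : i ≤ 1 := by exact_mod_cast hi
    interval_cases i
    · rw [norm_iteratedFDeriv_zero]
      exact (hn x).1
    · rw [norm_iteratedFDeriv_one]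
      have e : fderiv ℝ (fK n - gK) x = fderiv ℝ (f n) x - fderiv ℝ g x := fderiv_sub df dg
      rw [e]
      exact (hn x).2
  exact (hc.tendsto gK).comp hlim

end Convergence

section HalfPlane

variable {Z : ℝ}

/-- Small shifts of a test function towards negative coordinates stay inside a common compact part
of the half-plane. -/
theorem exists_compacts_shift (ψ : 𝓓^{1}(halfPlane Z, ℝ)) :
    ∃ K : Compacts (ℝ × ℝ), (K : Set (ℝ × ℝ)) ⊆ halfPlane Z ∧
      ∀ x, ∀ a ∈ Icc (0 : ℝ) 1, ∀ b ∈ Icc (0 : ℝ) 1, ψ (x.1 + a, x.2 + b) ≠ 0 → x ∈ K := by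
  have hc : IsCompact ((fun p : (ℝ × ℝ) × (ℝ × ℝ) => p.1 - p.2) ''
      (tsupport ψ ×ˢ (Icc (0 : ℝ) 1 ×ˢ Icc (0 : ℝ) 1))) :=
    (ψ.hasCompactSupport.isCompact.prod (isCompact_Icc.prod isCompact_Icc)).image (by fun_prop)
  refine ⟨⟨_, hc⟩, ?_, fun x a ha b hb h => ?_⟩
  · rintro _ ⟨⟨x, a, b⟩, ⟨hx, ha, hb⟩, rfl⟩
    have h1 : x.1 + x.2 < 2 * Z := ψ.tsupport_subset hx
    have h2 : 0 ≤ a := ha.1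
    have h3 : 0 ≤ b := hb.1
    change x.1 - a + (x.2 - b) < 2 * Z
    linarith
  · exact ⟨((x.1 + a, x.2 + b), (a, b)), ⟨subset_tsupport _ h, ha, hb⟩, by ext <;> simp⟩

theorem norm_shift_sub_le (ψ : 𝓓^{1}(halfPlane Z, ℝ)) {ε : ℝ} (hε : 0 < ε) :
    ∃ δ > 0, ∀ x h : ℝ × ℝ, ‖h‖ < δ →
      |ψ (x + h) - ψ x| ≤ ε ∧ ‖fderiv ℝ ψ (x + h) - fderiv ℝ ψ x‖ ≤ ε := by
  obtain ⟨δ₁, h1, H1⟩ := exists_modulus_of_continuity ψ.continuous ψ.hasCompactSupport hε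
  obtain ⟨δ₂, h2, H2⟩ := exists_modulus_of_continuity
    (ψ.contDiff.continuous_fderiv one_ne_zero) (ψ.hasCompactSupport.fderiv ℝ) hε
  exact ⟨min δ₁ δ₂, lt_min h1 h2, fun x h hh =>
    ⟨H1 x h (hh.trans_le (min_le_left _ _)), H2 x h (hh.trans_le (min_le_right _ _))⟩⟩

/-- A distribution of order at most one that vanishes on the test functions supported in `z < 0`
and on those supported in `t < 0` only sees the values of a test function on the closed
quadrant. -/
theorem apply_eq_zero_of_eqOn_quadrant {M : 𝓓'^{1}(halfPlane Z, Fin 4 → ℝ)}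
    (h₁ : ∀ φ : 𝓓^{1}(halfPlane Z, ℝ), tsupport φ ⊆ {x | x.1 < 0} → M φ = 0)
    (h₂ : ∀ φ : 𝓓^{1}(halfPlane Z, ℝ), tsupport φ ⊆ {x | x.2 < 0} → M φ = 0)
    {η : 𝓓^{1}(halfPlane Z, ℝ)} (hη : ∀ x : ℝ × ℝ, 0 ≤ x.1 → 0 ≤ x.2 → η x = 0) : M η = 0 := by
  obtain ⟨K, hKΩ, hK⟩ := exists_compacts_shift η
  let r (n : ℕ) : ℝ := 1 / ((n : ℝ) + 1)
  have hr0 (n : ℕ) : 0 < r n := by positivity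
  have hr1 (n : ℕ) : r n ≤ 1 := by
    simp only [r]
    rw [div_le_one (by positivity)]
    linarith [n.cast_nonneg (α := ℝ)]
  have hsupp (n : ℕ) (x : ℝ × ℝ) (h : η (x.1 + r n, x.2 + r n) ≠ 0) : x ∈ K :=
    hK x _ ⟨(hr0 n).le, hr1 n⟩ _ ⟨(hr0 n).le, hr1 n⟩ h
  have hsm (n : ℕ) : ContDiff ℝ 1 fun x : ℝ × ℝ => η (x.1 + r n, x.2 + r n) :=
    η.contDiff.comp (by fun_prop)
  let f (n : ℕ) : 𝓓^{1}(halfPlane Z, ℝ) := testOfCompact _ (hsm n) K hKΩ (hsupp n)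
  -- A shifted function is the sum of a function supported in `z < 0` and one supported in `t < 0`.
  have hf (n : ℕ) : M (f n) = 0 := by
    let θ : ℝ × ℝ → ℝ := fun x => Real.smoothTransition (-(2 / r n) * x.1 - 1)
    have hθ : ContDiff ℝ 1 θ := Real.smoothTransition.contDiff.comp (by fun_prop)
    have hr := hr0 n
    let f₁ : 𝓓^{1}(halfPlane Z, ℝ) := testOfCompact
      (fun x => θ x * η (x.1 + r n, x.2 + r n)) (hθ.mul (hsm n)) K hKΩ
      (fun x h => hsupp n x (right_ne_zero_of_mul h))
    let f₂ : 𝓓^{1}(halfPlane Z, ℝ) := testOfCompact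
      (fun x => (1 - θ x) * η (x.1 + r n, x.2 + r n)) ((contDiff_const.sub hθ).mul (hsm n)) K hKΩ
      (fun x h => hsupp n x (right_ne_zero_of_mul h))
    have e : f n = f₁ + f₂ := by
      ext x
      change η (x.1 + r n, x.2 + r n) =
        θ x * η (x.1 + r n, x.2 + r n) + (1 - θ x) * η (x.1 + r n, x.2 + r n)
      ring
    have e₁ : M f₁ = 0 := by
      refine h₁ f₁ ((closure_minimal (t := {x : ℝ × ℝ | x.1 ≤ -(r n / 2)}) (fun x hx => ?_)
        (isClosed_le continuous_fst continuous_const)).trans fun x hx => ?_)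
      · by_contra hlt
        refine left_ne_zero_of_mul (show θ x * _ ≠ 0 from hx)
          (Real.smoothTransition.zero_of_nonpos ?_)
        have : -(r n / 2) < x.1 := not_le.1 hlt
        have : 2 / r n * (-(r n / 2)) ≤ 2 / r n * x.1 := by gcongr
        have : 2 / r n * (-(r n / 2)) = -1 := by field_simp
        linarith
      · have : x.1 ≤ -(r n / 2) := hx
        change x.1 < 0
        linarith
    have e₂ : M f₂ = 0 := by
      refine h₂ f₂ ((closure_minimal (t := {x : ℝ × ℝ | x.2 ≤ -r n}) (fun x hx => ?_)
        (isClosed_le continuous_snd continuous_const)).trans fun x hx => ?_)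
      · have hx' : (1 - θ x) * η (x.1 + r n, x.2 + r n) ≠ 0 := hx
        by_contra hlt
        have h2 : -r n < x.2 := not_le.1 hlt
        have h1 : x.1 + r n < 0 := by
          by_contra h1
          exact right_ne_zero_of_mul hx' (hη _ (not_lt.1 h1) (by simp only; linarith))
        refine left_ne_zero_of_mul hx' (sub_eq_zero.2 (Eq.symm
          (Real.smoothTransition.one_of_one_le ?_)))
        have : 2 / r n * x.1 ≤ 2 / r n * (-r n) := by gcongr; linarith
        have : 2 / r n * (-r n) = -2 := by field_simp
        linarith
      · have : x.2 ≤ -r n := hx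
        change x.2 < 0
        linarith
    rw [e, map_add, e₁, e₂, add_zero]
  have hlim : Tendsto (fun n => M (f n)) atTop (𝓝 (M η)) := by
    refine tendsto_distribution_apply M K hKΩ hsupp
      (fun x hx => hK x 0 (by simp) 0 (by simp) (by simpa using hx)) fun ε hε => ?_
    obtain ⟨δ, hδ, H⟩ := norm_shift_sub_le η hε
    filter_upwards [(tendsto_one_div_add_atTop_nhds_zero_nat (𝕜 := ℝ)).eventually_lt_const hδ]
      with n hn x
    have hnorm : ‖((r n, r n) : ℝ × ℝ)‖ < δ := by
      rw [Prod.norm_mk, max_self, Real.norm_of_nonneg (hr0 n).le]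
      exact hn
    have hx := H x (r n, r n) hnorm
    have e : (f n : ℝ × ℝ → ℝ) = fun x => η (x + (r n, r n)) := rfl
    rw [e, fderiv_comp_add_right]
    exact hx
  simp only [hf] at hlim
  exact tendsto_nhds_unique hlim tendsto_const_nhds

/-- The average of a function over the time interval `[t, t + ε]`. -/
noncomputable def timeAverage (ε : ℝ) (f : ℝ × ℝ → ℝ) (x : ℝ × ℝ) : ℝ :=
  ∫ s in (0 : ℝ)..1, f (x.1, x.2 + ε * s)

section TimeAverage

variable {f : ℝ × ℝ → ℝ} (ε : ℝ)

theorem hasFDerivAt_timeAverage (hf : ContDiff ℝ 1 f) (x : ℝ × ℝ) :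
    HasFDerivAt (timeAverage ε f)
      (timeAverage ε (fun y => fderiv ℝ f y (1, 0)) x • ContinuousLinearMap.fst ℝ ℝ ℝ +
        timeAverage ε (fun y => fderiv ℝ f y (0, 1)) x • ContinuousLinearMap.snd ℝ ℝ ℝ) x ∧
      ContDiff ℝ 1 (timeAverage ε f) := by
  have hc := hf.continuous
  have hd (v : ℝ × ℝ) : Continuous fun y => fderiv ℝ f y v :=
    (hf.continuous_fderiv one_ne_zero).clm_apply continuous_const
  have hav {g : ℝ × ℝ → ℝ} (hg : Continuous g) : Continuous (timeAverage ε g) := by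
    refine intervalIntegral.continuous_parametric_intervalIntegral_of_continuous'
      (f := fun (x : ℝ × ℝ) s => g (x.1, x.2 + ε * s)) ?_ 0 1
    exact hg.comp (by fun_prop : Continuous fun p : (ℝ × ℝ) × ℝ => (p.1.1, p.1.2 + ε * p.2))
  have hfd (y : ℝ × ℝ) : HasFDerivAt f (fderiv ℝ f y) y :=
    (hf.differentiable one_ne_zero y).hasFDerivAt
  have h1 (z t : ℝ) : HasDerivAt (fun z' => timeAverage ε f (z', t))
      (timeAverage ε (fun y => fderiv ℝ f y (1, 0)) (z, t)) z := by
    refine hasDerivAt_integral_of_continuous (F := fun s z => f (z, t + ε * s))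
      (F' := fun s z => fderiv ℝ f (z, t + ε * s) (1, 0))
      (hc.comp (by fun_prop : Continuous fun p : ℝ × ℝ => (p.2, t + ε * p.1)))
      ((hd _).comp (by fun_prop : Continuous fun p : ℝ × ℝ => (p.2, t + ε * p.1)))
      (fun s z => ?_) 0 1 z
    exact HasFDerivAt.comp_hasDerivAt (f := fun z : ℝ => (z, t + ε * s)) z (hfd _)
      ((hasDerivAt_id z).prodMk (hasDerivAt_const z _))
  have h2 (z t : ℝ) : HasDerivAt (fun t' => timeAverage ε f (z, t'))
      (timeAverage ε (fun y => fderiv ℝ f y (0, 1)) (z, t)) t := by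
    refine hasDerivAt_integral_of_continuous (F := fun s t => f (z, t + ε * s))
      (F' := fun s t => fderiv ℝ f (z, t + ε * s) (0, 1))
      (hc.comp (by fun_prop : Continuous fun p : ℝ × ℝ => (z, p.2 + ε * p.1)))
      ((hd _).comp (by fun_prop : Continuous fun p : ℝ × ℝ => (z, p.2 + ε * p.1)))
      (fun s t => ?_) 0 1 t
    exact HasFDerivAt.comp_hasDerivAt (f := fun t : ℝ => (z, t + ε * s)) t (hfd _)
      ((hasDerivAt_const t z).prodMk ((hasDerivAt_id t).add_const _))
  exact ⟨hasFDerivAt_of_partials (f := fun z t => timeAverage ε f (z, t)) h1 h2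
      (hav (hd _)) (hav (hd _)) x,
    contDiff_one_of_partials (f := fun z t => timeAverage ε f (z, t)) h1 h2
      (hav (hd _)) (hav (hd _))⟩

theorem contDiff_timeAverage (hf : ContDiff ℝ 1 f) : ContDiff ℝ 1 (timeAverage ε f) :=
  (hasFDerivAt_timeAverage ε hf 0).2

theorem fderiv_timeAverage (hf : ContDiff ℝ 1 f) (x v : ℝ × ℝ) :
    fderiv ℝ (timeAverage ε f) x v = timeAverage ε (fun y => fderiv ℝ f y v) x := by
  have hd (v : ℝ × ℝ) : Continuous fun y => fderiv ℝ f y v :=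
    (hf.continuous_fderiv one_ne_zero).clm_apply continuous_const
  rw [(hasFDerivAt_timeAverage ε hf x).1.fderiv]
  simp only [timeAverage, _root_.add_apply, _root_.smul_apply,
    ContinuousLinearMap.coe_fst', ContinuousLinearMap.coe_snd', smul_eq_mul]
  rw [← intervalIntegral.integral_mul_const, ← intervalIntegral.integral_mul_const,
    ← intervalIntegral.integral_add]
  · refine intervalIntegral.integral_congr fun s _ => ?_
    have : v = v.1 • ((1, 0) : ℝ × ℝ) + v.2 • ((0, 1) : ℝ × ℝ) := by ext <;> simp
    conv_rhs => rw [this, map_add, map_smul, map_smul, smul_eq_mul, smul_eq_mul]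
    ring
  · exact (((hd _).comp (by fun_prop)).mul continuous_const).intervalIntegrable _ _
  · exact (((hd _).comp (by fun_prop)).mul continuous_const).intervalIntegrable _ _

/-- The time derivative of a time average is a difference quotient. This is where averaging gains a
derivative. -/
theorem fderiv_timeAverage_time (hε : ε ≠ 0) (hf : ContDiff ℝ 1 f) (x : ℝ × ℝ) :
    fderiv ℝ (timeAverage ε f) x (0, 1) = ε⁻¹ * (f (x.1, x.2 + ε) - f x) := by
  have hd : Continuous fun s : ℝ => fderiv ℝ f (x.1, x.2 + ε * s) (0, 1) :=
    ((hf.continuous_fderiv one_ne_zero).comp (by fun_prop)).clm_apply continuous_const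
  have hs (s : ℝ) : HasDerivAt (fun s => ε⁻¹ * f (x.1, x.2 + ε * s))
      (fderiv ℝ f (x.1, x.2 + ε * s) (0, 1)) s := by
    have h1 := (hf.differentiable one_ne_zero (x.1, x.2 + ε * s)).hasFDerivAt
    have h2 : HasDerivAt (fun s : ℝ => (x.1, x.2 + ε * s)) (0, ε) s :=
      (hasDerivAt_const s _).prodMk
        ((((hasDerivAt_id s).const_mul ε).const_add x.2).congr_deriv (mul_one ε))
    refine ((HasFDerivAt.comp_hasDerivAt (f := fun s : ℝ => (x.1, x.2 + ε * s)) s h1 h2).const_mul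
      ε⁻¹).congr_deriv ?_
    rw [show ((0 : ℝ), ε) = ε • ((0, 1) : ℝ × ℝ) by simp, map_smul, smul_eq_mul,
      inv_mul_cancel_left₀ hε]
  rw [fderiv_timeAverage ε hf, timeAverage,
    intervalIntegral.integral_eq_sub_of_hasDerivAt (fun s _ => hs s) (hd.intervalIntegrable _ _)]
  simp only [mul_one, mul_zero, add_zero]
  ring

theorem abs_timeAverage_sub_le {C : ℝ} {x : ℝ × ℝ} (hf : Continuous f)
    (h : ∀ s ∈ Icc (0 : ℝ) 1, |f (x.1, x.2 + ε * s) - f x| ≤ C) :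
    |timeAverage ε f x - f x| ≤ C := by
  have e : timeAverage ε f x - f x = ∫ s in (0 : ℝ)..1, (f (x.1, x.2 + ε * s) - f x) := by
    have hc : Continuous fun s : ℝ => f (x.1, x.2 + ε * s) := hf.comp (by fun_prop)
    rw [intervalIntegral.integral_sub (hc.intervalIntegrable _ _) intervalIntegrable_const]
    simp [timeAverage]
  rw [e]
  have := intervalIntegral.norm_integral_le_of_norm_le_const (a := 0) (b := 1) (C := C)
    (f := fun s => f (x.1, x.2 + ε * s) - f x) fun s hs => by
      rw [uIoc_of_le zero_le_one] at hs
      exact h s ⟨hs.1.le, hs.2⟩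
  simpa using this

theorem timeAverage_eq_zero {x : ℝ × ℝ} (h : ∀ s ∈ Icc (0 : ℝ) 1, f (x.1, x.2 + ε * s) = 0) :
    timeAverage ε f x = 0 := by
  rw [timeAverage, intervalIntegral.integral_congr (g := fun _ => 0)]
  · simp
  · intro s hs
    rw [uIcc_of_le zero_le_one] at hs
    exact h s hs

end TimeAverage

/-- If a distribution of order at most one vanishes on the time averages of a test function, it
vanishes on the test function. -/
theorem apply_eq_zero_of_timeAverage (M : 𝓓'^{1}(halfPlane Z, Fin 4 → ℝ)) (j : Fin 4)
    (ψ : 𝓓^{1}(halfPlane Z, ℝ))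
    (h : ∀ ε, 0 < ε → ε ≤ 1 → ∀ φ : 𝓓^{1}(halfPlane Z, ℝ),
      (∀ x, φ x = timeAverage ε ψ x) → M φ j = 0) : M ψ j = 0 := by
  obtain ⟨K, hKΩ, hK⟩ := exists_compacts_shift ψ
  let r (n : ℕ) : ℝ := 1 / ((n : ℝ) + 1)
  have hr0 (n : ℕ) : 0 < r n := by positivity
  have hr1 (n : ℕ) : r n ≤ 1 := by
    simp only [r]
    rw [div_le_one (by positivity)]
    linarith [n.cast_nonneg (α := ℝ)]
  have hsupp (n : ℕ) (x : ℝ × ℝ) (hx : timeAverage (r n) ψ x ≠ 0) : x ∈ K := by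
    by_contra hxK
    refine hx (timeAverage_eq_zero _ fun s hs => ?_)
    by_contra hne
    refine hxK (hK x 0 (by simp) (r n * s) ⟨mul_nonneg (hr0 n).le hs.1, ?_⟩ (by simpa using hne))
    exact mul_le_one₀ (hr1 n) hs.1 hs.2
  have hψ1 : ContDiff ℝ 1 ψ := ψ.contDiff
  let f (n : ℕ) : 𝓓^{1}(halfPlane Z, ℝ) :=
    testOfCompact _ (contDiff_timeAverage (r n) hψ1) K hKΩ (hsupp n)
  have hlim : Tendsto (fun n => M (f n)) atTop (𝓝 (M ψ)) := by
    refine tendsto_distribution_apply M K hKΩ hsupp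
      (fun x hx => hK x 0 (by simp) 0 (by simp) (by simpa using hx)) fun ε hε => ?_
    obtain ⟨δ, hδ, H⟩ := norm_shift_sub_le ψ hε
    filter_upwards [(tendsto_one_div_add_atTop_nhds_zero_nat (𝕜 := ℝ)).eventually_lt_const hδ]
      with n hn x
    have hsh (s : ℝ) (hs : s ∈ Icc (0 : ℝ) 1) : ‖((0, r n * s) : ℝ × ℝ)‖ < δ := by
      rw [Prod.norm_mk, norm_zero, max_eq_right (norm_nonneg _),
        Real.norm_of_nonneg (mul_nonneg (hr0 n).le hs.1)]
      exact (mul_le_of_le_one_right (hr0 n).le hs.2).trans_lt hn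
    have e : (f n : ℝ × ℝ → ℝ) = timeAverage (r n) ψ := rfl
    have hx (s : ℝ) : ((x.1, x.2 + r n * s) : ℝ × ℝ) = x + (0, r n * s) := by ext <;> simp
    rw [e]
    refine ⟨abs_timeAverage_sub_le _ hψ1.continuous fun s hs => ?_,
      ContinuousLinearMap.opNorm_le_bound _ hε.le fun v => ?_⟩
    · rw [hx]
      exact (H x _ (hsh s hs)).1
    · rw [_root_.sub_apply, fderiv_timeAverage _ hψ1]
      refine abs_timeAverage_sub_le (f := fun y => fderiv ℝ ψ y v) _
        ((hψ1.continuous_fderiv one_ne_zero).clm_apply continuous_const) fun s hs => ?_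
      rw [hx, ← _root_.sub_apply]
      exact ContinuousLinearMap.le_of_opNorm_le _ (H x _ (hsh s hs)).2 v
  have hlimj := ((continuous_apply j).tendsto _).comp hlim
  have h0 : ((fun v : Fin 4 → ℝ => v j) ∘ fun n => M (f n)) = fun _ => 0 :=
    funext fun n => h (r n) (hr0 n) (hr1 n) (f n) fun x => rfl
  rw [h0] at hlimj
  exact tendsto_nhds_unique hlimj tendsto_const_nhds

end HalfPlane

/-! ### The adjoint problem -/

/-- The adjoint system `-φ_t + A φ_z - β Bᵀ φ = ψ`, as a system of integral equations. The first and
third component are integrated from `z = 0`, and the second and fourth component from `z = R`, to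
the right of the supports of `β` and `ψ`. -/
noncomputable def adjointSystem (c R : ℝ) (β : ℝ → ℝ) : CharSystem (Fin 4) where
  T := LinearMap.toContinuousLinearMap (Matrix.mulVecLin (Matrix.diagonal (slope c) * (B c)ᵀ))
  β := β
  s := slope c
  k := 0
  r := ![0, R, 0, R]

theorem adjointSystem_T (c R : ℝ) (β : ℝ → ℝ) (v : Fin 4 → ℝ) (i : Fin 4) :
    (adjointSystem c R β).T v i = slope c i * ((B c)ᵀ *ᵥ v) i := by
  simp [adjointSystem, Matrix.mulVec_diagonal, Matrix.mulVec_transpose]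

theorem adjointSystem_start (c R : ℝ) (β : ℝ → ℝ) (i : Fin 4) (y : ℝ) :
    (adjointSystem c R β).start i y = ![0, R, 0, R] i := by
  simp [CharSystem.start, adjointSystem]

/-- Solutions of the adjoint system with a source supported in `z + t ≤ ρ` vanish where this
function is larger than `ρ`. For `z ≥ 0` it is `z + t`. For `z < 0` the slower characteristics
spread the influence of the source. -/
noncomputable def frontLevel (c : ℝ) (x : ℝ × ℝ) : ℝ := x.2 + min x.1 (x.1 / c)

theorem continuous_frontLevel (c : ℝ) : Continuous (frontLevel c) := by
  unfold frontLevel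
  fun_prop

section Geometry

variable {c R z₀ t₀ z : ℝ} {i : Fin 4}

/-- Along the part of a characteristic that enters the adjoint system, the time increases at least
as fast as the distance to the end point. -/
theorem adjoint_segment (hz : z ∈ uIcc (![0, R, 0, R] i) z₀) :
    (((z₀ ≤ z ∧ z ≤ 0) ∨ (0 ≤ z ∧ z ≤ z₀)) ∧ (slope c i = 1 ∨ slope c i = 1 / c)) ∨ R ≤ z ∨
      (z₀ ≤ z ∧ (slope c i = -1 ∨ slope c i = -(1 / c))) := by
  rw [mem_uIcc] at hz
  fin_cases i
  · left
    simp only [Fin.zero_eta, Matrix.cons_val_zero] at hz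
    exact ⟨hz.symm, Or.inl (by simp [slope])⟩
  · right
    simp only [Fin.mk_one, Matrix.cons_val_one, Matrix.cons_val_zero] at hz
    exact hz.imp (fun h => h.1) (fun h => ⟨h.1, Or.inl (by simp [slope])⟩)
  · left
    simp only [Fin.reduceFinMk, Matrix.cons_val] at hz
    exact ⟨hz.symm, Or.inr (by simp [slope])⟩
  · right
    simp only [Fin.reduceFinMk, Matrix.cons_val] at hz
    exact hz.imp (fun h => h.1) (fun h => ⟨h.1, Or.inr (by simp [slope])⟩)

theorem frontLevel_le_along (hc0 : 0 < c) (hc1 : c < 1) (hz : z ∈ uIcc (![0, R, 0, R] i) z₀) :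
    R ≤ z ∨ frontLevel c (z₀, t₀) ≤ frontLevel c (z, t₀ + slope c i * z₀ - slope c i * z) := by
  have hσ : 1 < 1 / c := by rw [lt_div_iff₀ hc0]; linarith
  have hs := adjoint_segment (c := c) hz
  unfold frontLevel
  simp only
  rw [div_eq_mul_one_div z₀ c, div_eq_mul_one_div z c]
  generalize 1 / c = σ at hσ hs ⊢
  rcases hs with ⟨⟨h1, h2⟩ | ⟨h1, h2⟩, hs⟩ | h | ⟨h1, hs⟩
  · right
    rw [min_eq_right (by nlinarith : z * σ ≤ z), min_eq_right (by nlinarith : z₀ * σ ≤ z₀)]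
    rcases hs with hs | hs <;> rw [hs] <;> nlinarith
  · right
    rw [min_eq_left (by nlinarith : z ≤ z * σ), min_eq_left (by nlinarith : z₀ ≤ z₀ * σ)]
    rcases hs with hs | hs <;> rw [hs] <;> nlinarith
  · exact Or.inl h
  · right
    have : min z₀ (z₀ * σ) ≤ min z (z * σ) := min_le_min h1 (by gcongr)
    rcases hs with hs | hs <;> rw [hs] <;> nlinarith

theorem adjoint_weight_decay (hc0 : 0 < c) (hc1 : c < 1) (hz : z ∈ uIcc (![0, R, 0, R] i) z₀)
    (h0 : 0 < z) (hR : z < R) (ρ : ℝ) :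
    ρ - (t₀ + slope c i * z₀ - slope c i * z) + max (-z) 0 / c + |z₀ - z| ≤
      ρ - t₀ + max (-z₀) 0 / c := by
  have hσ : 1 < 1 / c := by rw [lt_div_iff₀ hc0]; linarith
  have hs := adjoint_segment (c := c) hz
  have hmax : 0 ≤ max (-z₀) 0 / c := by positivity
  rw [max_eq_right (by linarith : -z ≤ 0), zero_div]
  generalize 1 / c = σ at hσ hs
  rcases hs with ⟨⟨h1, h2⟩ | ⟨h1, h2⟩, hs⟩ | h | ⟨h1, hs⟩
  · linarith
  · rw [abs_of_nonneg (by linarith : 0 ≤ z₀ - z)]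
    rcases hs with hs | hs <;> rw [hs] <;> nlinarith
  · linarith
  · rw [abs_of_nonpos (by linarith : z₀ - z ≤ 0)]
    rcases hs with hs | hs <;> rw [hs] <;> nlinarith

end Geometry

theorem abs_integral_le_of_support {f : ℝ → ℝ} {C Q : ℝ} (hf : Continuous f) (hQ : 0 ≤ Q)
    (hC : ∀ z, |f z| ≤ C) (h : ∀ z, f z ≠ 0 → |z| ≤ Q) (a b : ℝ) :
    |∫ z in a..b, f z| ≤ C * (2 * Q) := by
  have hs : ∀ z ∉ Icc (-Q) Q, f z = 0 := fun z hz => by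
    by_contra hne
    exact hz (abs_le.1 (h z hne))
  have hi : Integrable f := hf.integrable_of_hasCompactSupport
    (HasCompactSupport.intro isCompact_Icc hs)
  calc |∫ z in a..b, f z| ≤ ∫ z in uIoc a b, ‖f z‖ := by
        rw [← Real.norm_eq_abs]
        exact intervalIntegral.norm_integral_le_integral_norm_uIoc
    _ ≤ ∫ z, ‖f z‖ := setIntegral_le_integral hi.norm (Eventually.of_forall fun z => norm_nonneg _)
    _ = ∫ z in Icc (-Q) Q, ‖f z‖ := (setIntegral_eq_integral_of_forall_compl_eq_zero
        fun z hz => by rw [hs z hz, norm_zero]).symm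
    _ ≤ ∫ z in Icc (-Q) Q, C := setIntegral_mono hi.norm.integrableOn
        (integrableOn_const (by simp)) hC
    _ = C * (2 * Q) := by
        rw [setIntegral_const, measureReal_def, Real.volume_Icc, smul_eq_mul,
          ENNReal.toReal_ofReal (by linarith)]
        ring

/-- Solutions of the adjoint problem with homogeneous boundary values of the first and the third
component, for a source supported in `z + t ≤ ρ`. -/
theorem exists_adjoint_solution {c R ρ : ℝ} (hc0 : 0 < c) (hc1 : c < 1) {β : ℝ → ℝ}
    (hβ : ContDiff ℝ 1 β) (hβc : HasCompactSupport β) (hβ0 : ∀ z ≤ 0, β z = 0)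
    (hβR : ∀ z, R ≤ z → β z = 0) {ψ : ℝ × ℝ → Fin 4 → ℝ} (hψ : ContDiff ℝ 1 ψ)
    (hψc : HasCompactSupport ψ) (hψρ : ∀ x, ψ x ≠ 0 → x.1 + x.2 ≤ ρ)
    (hψR : ∀ x, R ≤ x.1 → ψ x = 0) :
    ∃ φ : ℝ × ℝ → Fin 4 → ℝ, ContDiff ℝ 1 φ ∧ (∀ x, ρ < frontLevel c x → φ x = 0) ∧
      (∀ t, φ (0, t) 0 = 0 ∧ φ (0, t) 2 = 0) ∧
      ∀ x i, fderiv ℝ φ x (1, -slope c i) i =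
        slope c i * (ψ x i + β x.1 * ((B c)ᵀ *ᵥ φ x) i) := by
  obtain ⟨b, hb⟩ := hβ.continuous.bounded_above_of_compact_support hβc
  set S := adjointSystem c R β with hS
  have hsrc {x : ℝ × ℝ} (hx : ρ < frontLevel c x) : ψ x = 0 := by
    by_contra hne
    refine (hψρ x hne).not_gt (hx.trans_le ?_)
    unfold frontLevel
    linarith [min_le_left x.1 (x.1 / c)]
  -- The data are the integrals of the source along the characteristics.
  let F (i : Fin 4) (z y : ℝ) : ℝ := slope c i * ψ (z, y - slope c i * z) i
  let F' (i : Fin 4) (z y : ℝ) : ℝ := slope c i * fderiv ℝ ψ (z, y - slope c i * z) (0, 1) i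
  have hF (i : Fin 4) : Continuous (Function.uncurry (F i)) :=
    continuous_const.mul ((continuous_apply i).comp (hψ.continuous.comp
      (by fun_prop : Continuous fun p : ℝ × ℝ => (p.1, p.2 - slope c i * p.1))))
  have hF' (i : Fin 4) : Continuous (Function.uncurry (F' i)) :=
    continuous_const.mul ((continuous_apply i).comp
      (((hψ.continuous_fderiv one_ne_zero).comp
        (by fun_prop : Continuous fun p : ℝ × ℝ => (p.1, p.2 - slope c i * p.1))).clm_apply
          continuous_const))
  have hFF' (i : Fin 4) (z y : ℝ) : HasDerivAt (F i z) (F' i z y) y := by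
    have h1 := (hψ.differentiable one_ne_zero (z, y - slope c i * z)).hasFDerivAt
    have h2 := HasFDerivAt.comp_hasDerivAt (f := fun y : ℝ => (z, y - slope c i * z)) y h1
      ((hasDerivAt_const y z).prodMk ((hasDerivAt_id y).sub_const _))
    exact (hasDerivAt_pi.1 h2 i).const_mul (slope c i)
  have hline (i : Fin 4) :=
    contDiff_integral_along_lines (hF i) (hF' i) (hFF' i) 0 (![0, R, 0, R] i) (slope c i)
  let a : ℝ × ℝ → Fin 4 → ℝ := fun x i =>
    ∫ z in (0 * (x.2 + slope c i * x.1) + ![0, R, 0, R] i)..x.1, F i z (x.2 + slope c i * x.1)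
  let a' : ℝ × ℝ → Fin 4 → ℝ := fun x => fderiv ℝ a x (0, 1)
  have ha1 : ContDiff ℝ 1 a := contDiff_pi.2 fun i => (hline i).1
  have hai (x v : ℝ × ℝ) (i : Fin 4) : fderiv ℝ a x v i = fderiv ℝ (fun x => a x i) x v := by
    have := hasFDerivAt_pi'.1 (ha1.differentiable one_ne_zero x).hasFDerivAt i
    rw [this.fderiv]
    rfl
  have had (z t : ℝ) : HasDerivAt (fun t' => a (z, t')) (a' (z, t)) t :=
    HasFDerivAt.comp_hasDerivAt (f := fun t : ℝ => (z, t)) t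
      (ha1.differentiable one_ne_zero (z, t)).hasFDerivAt
      ((hasDerivAt_const t z).prodMk (hasDerivAt_id t))
  obtain ⟨Q, hQ⟩ : ∃ Q, ∀ x ∈ tsupport ψ, ‖x‖ ≤ Q := hψc.isCompact.isBounded.exists_norm_le
  have hQ' (i : Fin 4) {g : ℝ × ℝ → ℝ} (hg : ∀ x ∉ tsupport ψ, g x = 0) (z y : ℝ)
      (hne : slope c i * g (z, y - slope c i * z) ≠ 0) : |z| ≤ max Q 0 := by
    have : (z, y - slope c i * z) ∈ tsupport ψ := by
      by_contra h
      exact hne (by rw [hg _ h, mul_zero])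
    exact (norm_fst_le _).trans ((hQ _ this).trans (le_max_left _ _))
  obtain ⟨C₁, hC₁⟩ := hψ.continuous.bounded_above_of_compact_support hψc
  obtain ⟨C₂, hC₂⟩ := ((hψ.continuous_fderiv one_ne_zero).clm_apply
    (continuous_const (y := ((0 : ℝ), (1 : ℝ))))).bounded_above_of_compact_support
      (hψc.fderiv_apply ℝ _)
  have hbound {C : ℝ} {g : ℝ × ℝ → Fin 4 → ℝ} (hC : ∀ x, ‖g x‖ ≤ C) (i : Fin 4) (x : ℝ × ℝ) :
      |slope c i * g x i| ≤ ‖slope c‖ * C := by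
    rw [abs_mul]
    exact mul_le_mul (norm_le_pi_norm (slope c) i) ((norm_le_pi_norm (g x) i).trans (hC x))
      (abs_nonneg _) (norm_nonneg _)
  have hcz {G : Fin 4 → ℝ → ℝ → ℝ} (hG : ∀ i, Continuous (Function.uncurry (G i))) (i : Fin 4)
      (y : ℝ) : Continuous fun z => G i z y :=
    (hG i).comp (by fun_prop : Continuous fun z : ℝ => (z, y))
  have hbd : CharSystem.IsBoundedData a a' (max (‖slope c‖ * C₁ * (2 * max Q 0))
      (‖slope c‖ * C₂ * (2 * max Q 0))) :=
    { continuous_data := ha1.continuous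
      continuous_deriv := (ha1.continuous_fderiv one_ne_zero).clm_apply continuous_const
      hasDerivAt := fun z t i => hasDerivAt_pi.1 (had z t) i
      norm_data_le := fun x => by
        refine le_max_of_le_left ?_
        have h0 : 0 ≤ C₁ := (norm_nonneg _).trans (hC₁ 0)
        rw [pi_norm_le_iff_of_nonneg (by positivity)]
        intro i
        refine abs_integral_le_of_support (hcz hF i _) (le_max_right _ _)
          (fun z => hbound hC₁ i _) (fun z => hQ' i (g := fun x => ψ x i) (fun x hx => ?_) z _) _ _
        rw [image_eq_zero_of_notMem_tsupport hx, Pi.zero_apply]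
      norm_deriv_le := fun x => by
        refine le_max_of_le_right ?_
        have h0 : 0 ≤ C₂ := (norm_nonneg _).trans (hC₂ 0)
        rw [pi_norm_le_iff_of_nonneg (by positivity)]
        intro i
        have e : a' x i = ∫ z in (0 * (x.2 + slope c i * x.1) + ![0, R, 0, R] i)..x.1,
            F' i z (x.2 + slope c i * x.1) := by
          simp only [a']
          rw [hai]
          refine ((hline i).2.2 x).trans ?_
          rw [zero_mul (F i _ _), neg_zero, zero_add]
        rw [e]
        refine abs_integral_le_of_support (hcz hF' i _) (le_max_right _ _)
          (fun z => hbound hC₂ i _)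
          (fun z => hQ' i (g := fun x => fderiv ℝ ψ x (0, 1) i) (fun x hx => ?_) z _) _ _
        rw [image_eq_zero_of_notMem_tsupport fun h => hx (tsupport_fderiv_subset ℝ h)]
        rfl }
  have ha0 : ∀ x ∈ {x | ρ < frontLevel c x}, a x = 0 := by
    intro x hx
    ext i
    simp only [a]
    rw [intervalIntegral.integral_congr (g := fun _ => 0)]
    · simp
    · intro z hz
      rw [zero_mul, zero_add] at hz
      have : ψ (z, x.2 + slope c i * x.1 - slope c i * z) = 0 := by
        rcases frontLevel_le_along (t₀ := x.2) hc0 hc1 hz with h | h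
        · exact hψR _ h
        · exact hsrc (lt_of_lt_of_le hx h)
      simp only [F]
      rw [this, Pi.zero_apply, mul_zero]
  have hV : IsOpen {x | ρ < frontLevel c x} := isOpen_lt continuous_const (continuous_frontLevel c)
  have hquiet : S.IsQuiet a a' {x | ρ < frontLevel c x} :=
    { data_eq_zero := ha0
      deriv_eq_zero := fun x hx => by
        have : a =ᶠ[𝓝 x] fun _ => 0 := by
          filter_upwards [hV.mem_nhds hx] with y hy using ha0 y hy
        simp only [a']
        rw [this.fderiv_eq]
        simp
      mem_of_mem := fun i x hx z hz => by
        rw [adjointSystem_start] at hz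
        rcases frontLevel_le_along (t₀ := x.2) hc0 hc1 hz with h | h
        · exact Or.inl (hβR z h)
        · exact Or.inr (lt_of_lt_of_le hx h) }
  have hweight : S.IsVolterraWeight b (fun x => ρ - x.2 + max (-x.1) 0 / c) :=
    { continuous_coeff := hβ.continuous
      abs_coeff_le := hb
      continuous_weight := by fun_prop
      weight_add_le := fun i x z hz hne => by
        rw [adjointSystem_start] at hz
        exact adjoint_weight_decay hc0 hc1 hz (not_le.1 fun h => hne (hβ0 z h))
          (not_le.1 fun h => hne (hβR z h)) ρ }
  obtain ⟨φ, hφ, hfix, hφV, hpde⟩ := CharSystem.exists_contDiff_solution hweight hbd ha1 hquiet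
    (fun x hx => by
      have h2 : -(max (-x.1) 0 / c) ≤ min x.1 (x.1 / c) := by
        rw [← neg_div]
        refine le_min ?_ ?_
        · rw [div_le_iff₀ hc0]
          rcases le_total x.1 0 with h | h
          · rw [max_eq_left (by linarith)]; nlinarith
          · rw [max_eq_right (by linarith)]; nlinarith
        · gcongr
          linarith [le_max_left (-x.1) 0]
      change ρ < x.2 + min x.1 (x.1 / c)
      linarith)
  have hstart (t : ℝ) (i : Fin 4) (hi : ![0, R, 0, R] i = 0) : φ (0, t) i = 0 := by
    rw [hfix, Pi.add_apply, CharSystem.op, adjointSystem_start, hi, intervalIntegral.integral_same,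
      add_zero]
    simp only [a]
    rw [hi, zero_mul, zero_add, intervalIntegral.integral_same]
  refine ⟨φ, hφ, hφV, fun t => ⟨hstart t 0 (by simp), hstart t 2 (by simp)⟩, fun x i => ?_⟩
  have h := hpde x i
  rw [hai, adjointSystem_T] at h
  have h2 : fderiv ℝ (fun x => a x i) x (1, -slope c i) = slope c i * ψ x i := by
    refine ((hline i).2.1 x).trans ?_
    simp [F]
  have e : fderiv ℝ φ x (1, -slope c i) i =
      fderiv ℝ (fun x => a x i) x (1, -slope c i) + β x.1 * (slope c i * ((B c)ᵀ *ᵥ φ x) i) := h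
  rw [e, h2]
  ring

/-! ### Uniqueness of impulsive solutions by duality -/

theorem contDiff_two_of_partials {f g₁ g₂ : ℝ × ℝ → ℝ} (hf : ContDiff ℝ 1 f)
    (h₁ : ∀ x, fderiv ℝ f x (1, 0) = g₁ x) (h₂ : ∀ x, fderiv ℝ f x (0, 1) = g₂ x)
    (c₁ : ContDiff ℝ 1 g₁) (c₂ : ContDiff ℝ 1 g₂) : ContDiff ℝ 2 f := by
  have e : fderiv ℝ f = fun x =>
      g₁ x • ContinuousLinearMap.fst ℝ ℝ ℝ + g₂ x • ContinuousLinearMap.snd ℝ ℝ ℝ := by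
    ext x
    · simp [h₁]
    · simp [h₂]
  rw [show (2 : WithTop ℕ∞) = 1 + 1 by norm_num, contDiff_succ_iff_fderiv]
  refine ⟨hf.differentiable one_ne_zero, by simp, ?_⟩
  rw [e]
  exact (c₁.smul contDiff_const).add (c₂.smul contDiff_const)

theorem frontLevel_mono_right {c z t t' : ℝ} (h : t ≤ t') :
    frontLevel c (z, t) ≤ frontLevel c (z, t') := by
  unfold frontLevel
  simp only
  linarith

theorem frontLevel_of_nonneg {c : ℝ} (hc0 : 0 < c) (hc1 : c < 1) {x : ℝ × ℝ} (hx : 0 ≤ x.1) :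
    frontLevel c x = x.1 + x.2 := by
  have : x.1 ≤ x.1 / c := by
    rw [le_div_iff₀ hc0]
    nlinarith
  rw [frontLevel, min_eq_left this, add_comm]

theorem frontLevel_of_nonpos {c : ℝ} (hc0 : 0 < c) (hc1 : c < 1) {x : ℝ × ℝ} (hx : x.1 ≤ 0) :
    frontLevel c x = x.1 / c + x.2 := by
  have : x.1 / c ≤ x.1 := by
    rw [div_le_iff₀ hc0]
    nlinarith
  rw [frontLevel, min_eq_right this, add_comm]

/-- The adjoint problem has solutions of class `C²` if its source is a time average. The time
average of a `C¹` solution has a time derivative of class `C¹`, and the differential equation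
passes this on to the other derivative. -/
theorem exists_contDiff_two_adjoint_solution {c R ρ ε : ℝ} (hc0 : 0 < c) (hc1 : c < 1)
    (hε : 0 < ε) {β : ℝ → ℝ}
    (hβ : ContDiff ℝ 1 β) (hβc : HasCompactSupport β) (hβ0 : ∀ z ≤ 0, β z = 0)
    (hβR : ∀ z, R ≤ z → β z = 0) {ψ : ℝ × ℝ → Fin 4 → ℝ} (hψ : ContDiff ℝ 1 ψ)
    (hψc : HasCompactSupport ψ) (hψρ : ∀ x, ψ x ≠ 0 → x.1 + x.2 ≤ ρ)
    (hψR : ∀ x, R ≤ x.1 → ψ x = 0) :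
    ∃ φ : Fin 4 → ℝ × ℝ → ℝ, (∀ i, ContDiff ℝ 2 (φ i)) ∧
      (∀ i x, ρ < frontLevel c x → φ i x = 0) ∧ (∀ t, φ 0 (0, t) = 0 ∧ φ 2 (0, t) = 0) ∧
      ∀ i x, -fderiv ℝ (φ i) x (0, 1) + ![1, -1, c, -c] i * fderiv ℝ (φ i) x (1, 0) -
        β x.1 * ∑ k, B c k i * φ k x = timeAverage ε (fun y => ψ y i) x := by
  obtain ⟨φ, hφ, hφ0, hφb, hφe⟩ := exists_adjoint_solution hc0 hc1 hβ hβc hβ0 hβR hψ hψc hψρ hψR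
  have hφi (i : Fin 4) : ContDiff ℝ 1 fun x => φ x i := contDiff_pi.1 hφ i
  have hψi (i : Fin 4) : ContDiff ℝ 1 fun x => ψ x i := contDiff_pi.1 hψ i
  have hfd (i : Fin 4) (x v : ℝ × ℝ) : fderiv ℝ (fun x => φ x i) x v = fderiv ℝ φ x v i := by
    rw [(hasFDerivAt_pi'.1 (hφ.differentiable one_ne_zero x).hasFDerivAt i).fderiv]
    rfl
  -- The averaged equation, along a characteristic direction.
  have hav (i : Fin 4) (x : ℝ × ℝ) :
      fderiv ℝ (timeAverage ε fun y => φ y i) x (1, 0) -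
          slope c i * fderiv ℝ (timeAverage ε fun y => φ y i) x (0, 1) =
        slope c i * (timeAverage ε (fun y => ψ y i) x +
          β x.1 * ∑ k, B c k i * timeAverage ε (fun y => φ y k) x) := by
    have hint (g : ℝ × ℝ → ℝ) (hg : Continuous g) :
        IntervalIntegrable (fun s => g (x.1, x.2 + ε * s)) volume 0 1 :=
      (hg.comp (by fun_prop)).intervalIntegrable _ _
    have e : ((1 : ℝ), -slope c i) = (1, 0) - slope c i • ((0, 1) : ℝ × ℝ) := by simp
    have h1 : fderiv ℝ (timeAverage ε fun y => φ y i) x (1, -slope c i) =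
        ∫ s in (0 : ℝ)..1, slope c i * (ψ (x.1, x.2 + ε * s) i +
          β x.1 * ∑ k, B c k i * φ (x.1, x.2 + ε * s) k) := by
      rw [fderiv_timeAverage ε (hφi i), timeAverage]
      refine intervalIntegral.integral_congr fun s _ => ?_
      rw [hfd, hφe]
      rfl
    rw [e, map_sub, map_smul, smul_eq_mul] at h1
    rw [h1, intervalIntegral.integral_const_mul, intervalIntegral.integral_add (hint _
      (hψi i).continuous), intervalIntegral.integral_const_mul,
      intervalIntegral.integral_finsetSum]
    · simp only [intervalIntegral.integral_const_mul]
      rfl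
    · exact fun k _ => (hint _ (hφi k).continuous).const_mul _
    · exact (continuous_const.mul (continuous_finsetSum _ fun k _ => continuous_const.mul
        ((hφi k).continuous.comp (by fun_prop)))).intervalIntegrable _ _
  have hT (i : Fin 4) : ContDiff ℝ 1 (timeAverage ε fun y => φ y i) :=
    contDiff_timeAverage ε (hφi i)
  have hdt (i : Fin 4) :
      ContDiff ℝ 1 fun x => fderiv ℝ (timeAverage ε fun y => φ y i) x (0, 1) := by
    simp only [fderiv_timeAverage_time ε hε.ne' (hφi i)]
    exact contDiff_const.mul (((hφi i).comp (by fun_prop)).sub (hφi i))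
  refine ⟨fun i => timeAverage ε fun y => φ y i, fun i => ?_, fun i x hx => ?_, fun t => ?_,
    fun i x => ?_⟩
  · refine contDiff_two_of_partials (hT i) (fun x => sub_eq_iff_eq_add.1 (hav i x)) (fun x => rfl)
      ?_ (hdt i)
    refine (contDiff_const.mul ((contDiff_timeAverage ε (hψi i)).add
      ((hβ.comp contDiff_fst).mul (ContDiff.sum fun k _ => contDiff_const.mul (hT k))))).add
      (contDiff_const.mul (hdt i))
  · refine timeAverage_eq_zero ε fun s hs => ?_
    rw [hφ0 _ (hx.trans_le (frontLevel_mono_right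
      (le_add_of_nonneg_right (mul_nonneg hε.le hs.1))))]
    rfl
  · exact ⟨timeAverage_eq_zero ε fun s _ => (hφb _).1, timeAverage_eq_zero ε fun s _ => (hφb _).2⟩
  · have hs := speed_mul_slope hc0.ne' i
    linear_combination ![1, -1, c, -c] i * hav i x +
      (fderiv ℝ (timeAverage ε fun y => φ y i) x (0, 1) + timeAverage ε (fun y => ψ y i) x +
          β x.1 * ∑ k, B c k i * timeAverage ε (fun y => φ y k) x) * hs

section Uniqueness

variable {c Z : ℝ} {β : ℝ → ℝ} {hβ : ContDiff ℝ 1 β}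

/-- The adjoint operator of the problem, applied to four test functions. -/
noncomputable def adjointTest (c : ℝ) (β : ℝ → ℝ) (hβ : ContDiff ℝ 1 β)
    (Φ : Fin 4 → 𝓓^{2}(halfPlane Z, ℝ)) (j : Fin 4) : 𝓓^{1}(halfPlane Z, ℝ) :=
  -dt (Φ j) + ![1, -1, c, -c] j • dz (Φ j) - ∑ i, B c i j • mulTest β hβ (Φ i)

theorem adjointTest_apply (Φ : Fin 4 → 𝓓^{2}(halfPlane Z, ℝ)) (j : Fin 4) (x : ℝ × ℝ) :
    adjointTest c β hβ Φ j x = -fderiv ℝ (Φ j) x (0, 1) +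
      ![1, -1, c, -c] j * fderiv ℝ (Φ j) x (1, 0) - β x.1 * ∑ i, B c i j * Φ i x := by
  rw [← dt_apply, ← dz_apply, Finset.mul_sum, adjointTest, Fin.sum_univ_four, Fin.sum_univ_four]
  change -dt (Φ j) x + ![1, -1, c, -c] j * dz (Φ j) x - (B c 0 j * (β x.1 * Φ 0 x) +
    B c 1 j * (β x.1 * Φ 1 x) + B c 2 j * (β x.1 * Φ 2 x) + B c 3 j * (β x.1 * Φ 3 x)) = _
  ring

/-- The difference of two impulsive solutions annihilates the range of the adjoint operator on test
functions whose first and third components vanish on the boundary: these are the components that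
meet the boundary values which are not prescribed. -/
theorem IsImpulsiveSolution.sum_sub_adjointTest {M M' : 𝓓'^{1}(halfPlane Z, Fin 4 → ℝ)}
    (hM : IsImpulsiveSolution c Z β hβ M) (hM' : IsImpulsiveSolution c Z β hβ M')
    (Φ : Fin 4 → 𝓓^{2}(halfPlane Z, ℝ)) (h0 : ∀ t, Φ 0 (0, t) = 0) (h2 : ∀ t, Φ 2 (0, t) = 0) :
    ∑ j, (M' - M) (adjointTest c β hβ Φ j) j = 0 := by
  obtain ⟨b, he, hb1, hb3⟩ := hM.equation
  obtain ⟨b', he', hb1', hb3'⟩ := hM'.equation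
  have t0 : traceTest (Φ 0) = 0 := by ext t; exact h0 t
  have t2 : traceTest (Φ 2) = 0 := by ext t; exact h2 t
  have e (i : Fin 4) := congr_fun (he (Φ i)) i
  have e' (i : Fin 4) := congr_fun (he' (Φ i)) i
  simp only [Pi.sub_apply, Pi.add_apply, Pi.neg_apply, A_mulVec] at e e'
  simp only [Matrix.mulVec, dotProduct, Fin.sum_univ_four] at e e'
  have bb (i : Fin 4) : b' (traceTest (Φ i)) i = b (traceTest (Φ i)) i := by
    fin_cases i
    · simp [t0]
    · exact (hb1' _).trans (hb1 _).symm
    · simp [t2]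
    · exact (hb3' _).trans (hb3 _).symm
  have key (L : 𝓓'^{1}(halfPlane Z, Fin 4 → ℝ)) (j : Fin 4) :
      L (adjointTest c β hβ Φ j) j = -(L (dt (Φ j)) j) + ![1, -1, c, -c] j * L (dz (Φ j)) j -
        ∑ i, B c i j * L (mulTest β hβ (Φ i)) j := by
    rw [adjointTest, map_sub, map_add, map_neg, map_smul, map_sum]
    simp only [map_smul, Pi.sub_apply, Pi.add_apply, Pi.neg_apply, Pi.smul_apply, smul_eq_mul,
      Finset.sum_apply]
  have s (j : Fin 4) : (M' - M) (adjointTest c β hβ Φ j) j =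
      M' (adjointTest c β hβ Φ j) j - M (adjointTest c β hβ Φ j) j := rfl
  simp only [s, key, Fin.sum_univ_four]
  linear_combination e' 0 + e' 1 + e' 2 + e' 3 - e 0 - e 1 - e 2 - e 3 -
    ![1, -1, c, -c] 0 * bb 0 - ![1, -1, c, -c] 1 * bb 1 - ![1, -1, c, -c] 2 * bb 2 -
    ![1, -1, c, -c] 3 * bb 3

/-- The part of the half-plane where a test function for the duality argument may be nonzero. -/
theorem isCompact_frontLevel_le {ρ δ : ℝ} (hc0 : 0 < c) (hc1 : c < 1) :
    IsCompact {x : ℝ × ℝ | -δ ≤ x.1 ∧ -1 ≤ x.2 ∧ frontLevel c x ≤ ρ} := by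
  refine (isCompact_Icc (a := ((-δ, -1) : ℝ × ℝ))
    (b := ((|ρ| + 1, |ρ| + |δ| / c) : ℝ × ℝ))).of_isClosed_subset ?_ ?_
  · exact (isClosed_le continuous_const continuous_fst).inter
      ((isClosed_le continuous_const continuous_snd).inter
        (isClosed_le (continuous_frontLevel c) continuous_const))
  · rintro x ⟨h1, h2, h3⟩
    have hρ := le_abs_self ρ
    have hρ0 := abs_nonneg ρ
    have hδc : 0 ≤ |δ| / c := by positivity
    refine ⟨⟨h1, h2⟩, ?_, ?_⟩
    · change x.1 ≤ |ρ| + 1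
      rcases le_total 0 x.1 with h | h
      · rw [frontLevel_of_nonneg hc0 hc1 h] at h3
        linarith
      · linarith
    · change x.2 ≤ |ρ| + |δ| / c
      rcases le_total 0 x.1 with h | h
      · rw [frontLevel_of_nonneg hc0 hc1 h] at h3
        linarith
      · rw [frontLevel_of_nonpos hc0 hc1 h] at h3
        have : -(|δ| / c) ≤ x.1 / c := by
          rw [← neg_div]
          gcongr
          linarith [le_abs_self δ]
        linarith

/-- Impulsive solutions are unique. Their difference is tested with a solution of the adjoint
problem whose source is a given test function, cut off outside the quadrant `z ≥ 0`, `t ≥ 0`. -/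
theorem IsImpulsiveSolution.eq (hc0 : 0 < c) (hc1 : c < 1) (hZ : 0 < Z) (h0 : β 0 = 0)
    (h1 : deriv β 0 = 0) {M M' : 𝓓'^{1}(halfPlane Z, Fin 4 → ℝ)}
    (hM : IsImpulsiveSolution c Z β hβ M) (hM' : IsImpulsiveSolution c Z β hβ M') : M' = M := by
  rw [← sub_eq_zero]
  have hD1 (φ : 𝓓^{1}(halfPlane Z, ℝ)) (h : tsupport φ ⊆ {x | x.1 < 0}) : (M' - M) φ = 0 :=
    (congr_arg₂ (· - ·) (hM'.supported φ h) (hM.supported φ h)).trans (sub_zero 0)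
  have hD2 (φ : 𝓓^{1}(halfPlane Z, ℝ)) (h : tsupport φ ⊆ {x | x.2 < 0}) : (M' - M) φ = 0 :=
    (congr_arg₂ (· - ·) (hM'.initial φ h) (hM.initial φ h)).trans (sub_zero 0)
  ext ψ j
  refine apply_eq_zero_of_timeAverage (M' - M) j ψ fun ε hε _ ψε hψε => ?_
  have hsc := ψ.hasCompactSupport.isCompact
  -- The source lives in `z + t ≤ ρ` for some `ρ < 2Z`.
  obtain ⟨ρ, hρZ, hρ⟩ : ∃ ρ < 2 * Z, ∀ x, ψ x ≠ 0 → x.1 + x.2 ≤ ρ := by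
    rcases (tsupport ψ).eq_empty_or_nonempty with he | hne
    · refine ⟨0, by linarith, fun x hx => ?_⟩
      have := subset_tsupport ψ hx
      rw [he] at this
      exact this.elim
    · obtain ⟨y, hy, hmax⟩ := hsc.exists_isMaxOn hne
        (f := fun x : ℝ × ℝ => x.1 + x.2) (by fun_prop)
      exact ⟨y.1 + y.2, ψ.tsupport_subset hy, fun x hx => hmax (subset_tsupport ψ hx)⟩
  obtain ⟨Q, hQ⟩ := hsc.exists_bound_of_continuousOn (f := fun x : ℝ × ℝ => x.1) (by fun_prop)
  obtain ⟨βt, hβt, hβtc, hβt0, hβtR, hβte⟩ := exists_truncation hβ h0 h1 (max |ρ| Q)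
  let Ψ : ℝ × ℝ → Fin 4 → ℝ := fun x => ψ x • Pi.single j 1
  have hΨ0 (x : ℝ × ℝ) (hx : Ψ x ≠ 0) : ψ x ≠ 0 := fun h => hx (by simp [Ψ, h])
  have hψ1 : ContDiff ℝ 1 ψ := ψ.contDiff
  obtain ⟨φ, hφ, hφ0, hφb, hφe⟩ := exists_contDiff_two_adjoint_solution (ρ := ρ) (ψ := Ψ)
    hc0 hc1 hε hβt hβtc hβt0 hβtR (hψ1.smul contDiff_const) ψ.hasCompactSupport.smul_right
    (fun x hx => hρ x (hΨ0 x hx)) (fun x hx => by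
      by_contra hne
      have := hQ x (subset_tsupport ψ (hΨ0 x hne))
      have h2 := le_max_right |ρ| Q
      have h3 := le_abs_self x.1
      rw [Real.norm_eq_abs] at this
      linarith)
  -- The cut-off is supported in `z ≥ -δ`, `t ≥ -1`. The number `δ` is so small that the adjoint
  -- solution vanishes near the line `z + t = 2Z` there.
  set δ := (2 * Z - ρ) * c / 2 with hδ
  have hδ0 : 0 < δ := by
    have : 0 < 2 * Z - ρ := by linarith
    positivity
  let κ : ℝ × ℝ → ℝ := fun x =>
    Real.smoothTransition (2 / δ * x.1 + 2) * Real.smoothTransition (2 * x.2 + 2)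
  have hκ : ContDiff ℝ 2 κ := (Real.smoothTransition.contDiff.comp (by fun_prop)).mul
    (Real.smoothTransition.contDiff.comp (by fun_prop))
  have hκ1 {x : ℝ × ℝ} (h1 : -(δ / 2) < x.1) (h2 : -(1 / 2) < x.2) : κ x = 1 := by
    have : 2 / δ * (-(δ / 2)) ≤ 2 / δ * x.1 := by gcongr
    have : 2 / δ * (-(δ / 2)) = -1 := by field_simp
    simp only [κ]
    rw [Real.smoothTransition.one_of_one_le (by linarith),
      Real.smoothTransition.one_of_one_le (by linarith), one_mul]
  let K : Compacts (ℝ × ℝ) := ⟨_, isCompact_frontLevel_le (ρ := ρ) (δ := δ) hc0 hc1⟩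
  have hKΩ : (K : Set (ℝ × ℝ)) ⊆ halfPlane Z := by
    rintro x ⟨h1, -, h3⟩
    change x.1 + x.2 < 2 * Z
    rcases le_total 0 x.1 with h | h
    · rw [frontLevel_of_nonneg hc0 hc1 h] at h3
      linarith
    · rw [frontLevel_of_nonpos hc0 hc1 h] at h3
      have h4 : -δ / c ≤ x.1 / c := by gcongr
      have h5 : -δ / c = -((2 * Z - ρ) / 2) := by rw [hδ]; field_simp
      linarith
  have hsupp (i : Fin 4) (x : ℝ × ℝ) (hx : κ x * φ i x ≠ 0) : x ∈ K := by
    have hκx := left_ne_zero_of_mul hx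
    refine ⟨?_, ?_, ?_⟩
    · by_contra h
      refine left_ne_zero_of_mul hκx (Real.smoothTransition.zero_of_nonpos ?_)
      have : 2 / δ * x.1 ≤ 2 / δ * (-δ) := by gcongr; exact (not_le.1 h).le
      have : 2 / δ * (-δ) = -2 := by field_simp
      linarith
    · by_contra h
      refine right_ne_zero_of_mul hκx (Real.smoothTransition.zero_of_nonpos ?_)
      linarith [not_le.1 h]
    · by_contra h
      exact right_ne_zero_of_mul hx (hφ0 i x (not_le.1 h))
  let Φ (i : Fin 4) : 𝓓^{2}(halfPlane Z, ℝ) :=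
    testOfCompact (fun x => κ x * φ i x) (hκ.mul (hφ i)) K hKΩ (hsupp i)
  have hΦ (i : Fin 4) (x : ℝ × ℝ) : Φ i x = κ x * φ i x := rfl
  have hsum := hM.sum_sub_adjointTest hM' Φ (fun t => by rw [hΦ, (hφb t).1, mul_zero])
    (fun t => by rw [hΦ, (hφb t).2, mul_zero])
  -- In the quadrant the adjoint operator maps the cut-off solution to the averaged source.
  have hquad (i : Fin 4) (x : ℝ × ℝ) (hx1 : 0 ≤ x.1) (hx2 : 0 ≤ x.2) :
      adjointTest c β hβ Φ i x = if i = j then ψε x else 0 := by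
    have hev (i : Fin 4) : (Φ i : ℝ × ℝ → ℝ) =ᶠ[𝓝 x] φ i := by
      have hU : {y : ℝ × ℝ | -(δ / 2) < y.1} ∩ {y : ℝ × ℝ | -(1 / 2) < y.2} ∈ 𝓝 x :=
        ((isOpen_lt continuous_const continuous_fst).inter
          (isOpen_lt continuous_const continuous_snd)).mem_nhds
          ⟨by change -(δ / 2) < x.1; linarith, by change -(1 / 2) < x.2; linarith⟩
      filter_upwards [hU] with y hy
      rw [hΦ, hκ1 hy.1 hy.2, one_mul]
    have hβx : β x.1 * ∑ k, B c k i * φ k x = βt x.1 * ∑ k, B c k i * φ k x := by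
      rcases le_or_gt x.1 (max |ρ| Q) with h | h
      · rw [hβte ⟨hx1, h⟩]
      · have hz (k : Fin 4) : φ k x = 0 := hφ0 k x (by
          rw [frontLevel_of_nonneg hc0 hc1 hx1]
          linarith [le_abs_self ρ, le_max_left |ρ| Q])
        simp [hz]
    have hval (i : Fin 4) : Φ i x = φ i x := (hev i).eq_of_nhds
    rw [adjointTest_apply, (hev i).fderiv_eq]
    simp only [hval]
    rw [hβx, hφe i x]
    split_ifs with hij
    · rw [hψε]
      simp [Ψ, hij]
    · exact timeAverage_eq_zero ε fun s _ => by simp [Ψ, hij]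
  have hz (i : Fin 4) (hi : i ≠ j) : (M' - M) (adjointTest c β hβ Φ i) i = 0 := by
    rw [apply_eq_zero_of_eqOn_quadrant hD1 hD2 fun x hx1 hx2 => by
      rw [hquad i x hx1 hx2, if_neg hi]]
    rfl
  rw [Finset.sum_eq_single j (fun i _ hi => hz i hi) (by simp)] at hsum
  have hj : (M' - M) (ψε - adjointTest c β hβ Φ j) = 0 :=
    apply_eq_zero_of_eqOn_quadrant hD1 hD2 fun x hx1 hx2 => by
      change ψε x - adjointTest c β hβ Φ j x = 0
      rw [hquad j x hx1 hx2, if_pos rfl, sub_self]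
  rw [map_sub, sub_eq_zero] at hj
  rw [hj, hsum]

end Uniqueness

theorem deriv_zero_of_eqOn {Z : ℝ} (hZ : 0 < Z) {β βe : ℝ → ℝ} (hβe : ContDiff ℝ 1 βe)
    (he : EqOn βe β (Icc 0 Z)) (h : derivWithin β (Icc 0 Z) 0 = 0) : deriv βe 0 = 0 := by
  have h0 : (0 : ℝ) ∈ Icc 0 Z := ⟨le_rfl, hZ.le⟩
  rw [← (hβe.differentiable one_ne_zero 0).derivWithin (uniqueDiffOn_Icc hZ 0 h0),
    derivWithin_congr he (he h0), h]

end TwistedFiber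

theorem theorem1p1 (c Z : ℝ) (hc0 : 0 < c) (hc1 : c < 1) (hZ : 0 < Z)
    (β : ℝ → ℝ) (hβ : ContDiffOn ℝ 1 β (Set.Icc 0 Z)) (hβ0 : β 0 = 0)
    (hβ1 : derivWithin β (Set.Icc 0 Z) 0 = 0) :
    ∃ m : ℝ × ℝ → Fin 4 → ℝ,
      TwistedFiber.IsCharacteristicSolution c Z β m ∧
      (∀ m' : ℝ × ℝ → Fin 4 → ℝ, TwistedFiber.IsCharacteristicSolution c Z β m' →
        Set.EqOn m' m (TwistedFiber.triangle Z)) ∧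
      ∃ M : 𝓓'^{1}(TwistedFiber.halfPlane Z, Fin 4 → ℝ),
        TwistedFiber.HasProgressingForm Z m M ∧
        ∀ (βe : ℝ → ℝ) (hβe : ContDiff ℝ 1 βe), Set.EqOn βe β (Set.Icc 0 Z) →
          TwistedFiber.IsImpulsiveSolution c Z βe hβe M ∧
          ∀ M' : 𝓓'^{1}(TwistedFiber.halfPlane Z, Fin 4 → ℝ),
            TwistedFiber.IsImpulsiveSolution c Z βe hβe M' → M' = M := by
  have h0 {βe : ℝ → ℝ} (he : Set.EqOn βe β (Set.Icc 0 Z)) : βe 0 = 0 :=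
    (he ⟨le_rfl, hZ.le⟩).trans hβ0
  obtain ⟨β₀, hβ₀, he₀⟩ := TwistedFiber.exists_contDiff_extension hZ hβ
  have h1 := TwistedFiber.deriv_zero_of_eqOn hZ hβ₀ he₀ hβ1
  obtain ⟨m, hm⟩ := TwistedFiber.exists_isCharacteristicSolution hc0 hc1 hZ hβ₀ (h0 he₀) h1 he₀
  obtain ⟨M, hM⟩ := TwistedFiber.exists_hasProgressingForm hm.contDiffOn.continuousOn
  have hsol := hm.isImpulsiveSolution hc0 hc1 hZ hβ₀ he₀ hM
  refine ⟨m, hm, fun m' hm' => ?_, M, hM, fun βe hβe he =>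
    ⟨hm.isImpulsiveSolution hc0 hc1 hZ hβe he hM, fun M' hM' => ?_⟩⟩
  · -- Two characteristic solutions give the same impulsive solution.
    obtain ⟨M', hM'⟩ := TwistedFiber.exists_hasProgressingForm hm'.contDiffOn.continuousOn
    have e : M' = M := hsol.eq hc0 hc1 hZ (h0 he₀) h1
      (hm'.isImpulsiveSolution hc0 hc1 hZ hβ₀ he₀ hM')
    exact hM.eqOn hZ hm.contDiffOn.continuousOn hm'.contDiffOn.continuousOn (e ▸ hM')
  · exact (hm.isImpulsiveSolution hc0 hc1 hZ hβe he hM).eq hc0 hc1 hZ (h0 he)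
      (TwistedFiber.deriv_zero_of_eqOn hZ hβe he hβ1) hM'
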